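/- **Model.** Let $0<p<1$, $q=1-p$ and $0<p_r<1$. For $l\ge 0$ let $\mathcal X_l$ be the union of the $2^{l+1}$ *streets* of level $l$, i.e. the horizontal segments $[0,1]\times\{b2^{-(l+1)}\}$ and the vertical segments $\{b2^{-(l+1)}\}\times[0,1]$ with $b=1,3,\dots,2^{l+1}-1$; $\mathcal X_0$ is the *central cross*. Exactly $n$ users are placed independently: a user has level $l$ with probability $p\,q^l$ and, given $l$, is uniform on $\mathcal X_l$. Independently, the crossing of a horizontal street of level $h$ and a vertical street of level $v$ carries a Poisson number of auxiliary points with mean $\rho\, p_r^2\left(\frac{1-p_r}{2}\right)^{h+v}$, independently over crossings, with $\rho=n$; a fixed relay stands at each crossing that carries at least one point. Put $d_F=\log(4/q)/\log 2$ and $d_r=2\log(2/(1-p_r))/\log 2$. A hop along a street joins two distinct nodes of that street (users on it, or relays at its crossings) with no user of the street strictly between them. A hop along a street that carries $m$ users costs the power $P_{\max}/\max(m,1)^{\delta}$, where $\delta\ge2$ and $P_{\max}>0$. The accumulated energy of a route is the sum of the costs of its hops. $G_1(n,E)$ is the set of users joined to some node of the central cross by a route of accumulated energy at most $E$ that goes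 through at most one fixed relay. **Theorem.** Assume $d_F>3$ and $d_r<d_F-1$. Let $0<\alpha<1$, $c_E>0$, $E_n=c_E\,n^{(1-\delta)(1-\alpha)}P_{\max}$ and $0\le\theta<\tfrac12$. For users $u,v$ let $D_n(u,v)\in\mathbb N\cup\{\infty\}$ be the least number of hops of a route from $u$ to $v$ of accumulated energy at most $E_n$. There are constants $C,K$ and integers $x_n\ge0$ with $\left|x_n-\alpha\frac{\log n}{\log(2/q)}\right|\le K$ for all $n\geq 1$ such that, as $n\to\infty$: 1. with probability tending to $1$, $D_n(u,v)\le C\,n^{1-\alpha/(d_F-1)}$ simultaneously for all $u,v\in G_1(n,\theta E_n)$; 2. for every $\varepsilon>0$, with probability tending to $1$, all but at most $\varepsilon\,|G_1(n,E_n)|^2$ of the ordered pairs $(u,v)$ of users of $G_1(n,E_n)$ satisfy $D_n(u,v)\le C\,n^{1-\alpha/(d_F-1)}$; 3. with probability tending to $1$, any two users $u,v$ standing on the two different segments of the central cross are joined by a route of accumulated energy at most $E_n$, with at most $C\,n^{1-\alpha/(d_F-1)}$ hops, whose fixed relays are exactly three: one at a crossing of the street of $u$ with a street $s$ of level $x_n$,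 one at a crossing of $s$ with a street $t$ of level $x_n$, and one at a crossing of $t$ with the street of $v$. -/

import Mathlib

open Filter Topology MeasureTheory

noncomputable section

namespace Hyperfractal

/-- An axis-parallel dyadic line of level `l`: its constant coordinate is `b * 2^{-(l+1)}` with
`b = 2 * idx + 1` odd, `1 ≤ b ≤ 2^{l+1} - 1`. -/
structure Line where
  level : ℕ
  idx : Fin (2 ^ level)

/-- The constant coordinate of a dyadic line. -/
def Line.coord (a : Line) : ℝ := (2 * ((a.idx : ℕ) : ℝ) + 1) / 2 ^ (a.level + 1)

/-- A street of the hyperfractal support: the segment `[0,1] × {coord}` if `horizontal = true`,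
the segment `{coord} × [0,1]` otherwise. The set `𝒳_l` is the union of the `2^{l+1}` streets of
level `l`; the two streets of level `0` form the central cross. -/
structure Street where
  horizontal : Bool
  line : Line

def Street.level (s : Street) : ℕ := s.line.level

instance : MeasurableSpace Street := ⊤

/-- The intersection of the horizontal street at height `row.coord` and of the vertical street at
abscissa `col.coord`. -/
structure Crossing where
  row : Line
  col : Line

/-- The street `s` is one of the two streets that meet at the crossing `c`. -/
def Crossing.On (c : Crossing) (s : Street) : Prop :=
  s = ⟨true, c.row⟩ ∨ s = ⟨false, c.col⟩

/-- Position of the crossing `c` along the street `s`, measured on `[0,1]` (used when `c.On s`). -/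
def Crossing.pos (c : Crossing) (s : Street) : ℝ :=
  if s.horizontal then c.col.coord else c.row.coord

/-- The fractal dimension `d_F = log (4/q) / log 2` of the mobile users, where `q = 1 - p`. -/
def userDim (p : ℝ) : ℝ := Real.log (4 / (1 - p)) / Real.log 2

/-- The fractal dimension `d_r = 2 log (2/(1-p_r)) / log 2` of the relays. -/
def relayDim (pr : ℝ) : ℝ := 2 * (Real.log (2 / (1 - pr)) / Real.log 2)

/-- The law of one mobile user, given by its street and its position on that street: the level is
`l` with probability `p (1-p)^l`, the street is uniform among the `2^{l+1}` streets of level `l`,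
and the position on the street is uniform on `[0,1]`. -/
def userLaw (p : ℝ) : Measure (Street × ℝ) :=
  (Measure.sum fun s : Street =>
    ENNReal.ofReal (p * (1 - p) ^ s.level / 2 ^ (s.level + 1)) • Measure.dirac s).prod
  (volume.restrict (Set.Icc (0 : ℝ) 1))

/-- The mean `ρ p_r² ((1-p_r)/2)^{h+v}` of the auxiliary Poisson process at a crossing of a
horizontal street of level `h` and a vertical street of level `v`. -/
def relayMean (pr ρ : ℝ) (c : Crossing) : NNReal :=
  Real.toNNReal (ρ * (pr ^ 2 * ((1 - pr) / 2) ^ (c.row.level + c.col.level)))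

/-- A realization: street and position of each of the `n` users, and number of auxiliary Poisson
points at each crossing. -/
abbrev Config (n : ℕ) : Type := (Fin n → Street × ℝ) × (Crossing → ℕ)

/-- The law of the hyperfractal with exactly `n` independent users and, independently of them,
an auxiliary Poisson process of total mean `ρ` on the crossings. -/
def law (p pr ρ : ℝ) (n : ℕ) : Measure (Config n) :=
  (Measure.pi fun _ : Fin n => userLaw p).prod
    (Measure.infinitePi fun c : Crossing => ProbabilityTheory.poissonMeasure (relayMean pr ρ c))

/-- Nodes: users, and crossings regarded as possible sites of a fixed relay. -/
abbrev Node (n : ℕ) : Type := Fin n ⊕ Crossing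

variable {n : ℕ}

/-- The street of user `i`. -/
def street (ω : Config n) (i : Fin n) : Street := (ω.1 i).1

/-- `a` is a node of the network that stands on the street `s`. A crossing is a node if and only if
it carries at least one auxiliary point; the relay there stands on both streets. -/
def OnStreet (ω : Config n) (s : Street) : Node n → Prop
  | Sum.inl i => street ω i = s
  | Sum.inr c => 0 < ω.2 c ∧ c.On s

/-- Position of a node along the street `s`. -/
def pos (ω : Config n) (s : Street) : Node n → ℝ
  | Sum.inl i => (ω.1 i).2
  | Sum.inr c => c.pos s

/-- A one-hop transmission along the street `s` between two distinct nodes of `s`: no user of `s`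
stands strictly between them. -/
def Hop (ω : Config n) (s : Street) (a b : Node n) : Prop :=
  OnStreet ω s a ∧ OnStreet ω s b ∧ a ≠ b ∧
    ∀ i : Fin n, street ω i = s →
      (ω.1 i).2 ∉ Set.Ioo (min (pos ω s a) (pos ω s b)) (max (pos ω s a) (pos ω s b))

/-- The number `m` of users on the street `s`. -/
def streetCount (ω : Config n) (s : Street) : ℕ := {i : Fin n | street ω i = s}.ncard

/-- The nominal power `P_max / m^δ` of every transmission on the street `s`, `m` being the number of
users of `s`; it is `P_max` on a street without users. -/
def power (Pmax δ : ℝ) (ω : Config n) (s : Street) : ℝ :=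
  Pmax / (max (streetCount ω s : ℝ) 1) ^ δ

/-- A route, recorded as the list of its hops (street used, node reached). -/
abbrev Route (n : ℕ) : Type := List (Street × Node n)

/-- The route `r` leads from the node `a` to the node `b`. -/
def IsRoute (ω : Config n) : Node n → Route n → Node n → Prop
  | a, [], b => a = b
  | a, h :: r, b => Hop ω h.1 a h.2 ∧ IsRoute ω h.2 r b

/-- The accumulated energy of a route: the sum of the powers of its transmissions. -/
def energy (Pmax δ : ℝ) (ω : Config n) (r : Route n) : ℝ :=
  (r.map fun h => power Pmax δ ω h.1).sum

/-- The fixed relays that a route reaches, in order. -/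
def relays (r : Route n) : List Crossing := r.filterMap fun h => h.2.getRight?

/-- `G_k(n,E)`: the users connected to the central cross by a route of accumulated energy at most `E`
that goes through at most `k` fixed relays. -/
def giant (Pmax δ : ℝ) (ω : Config n) (k : ℕ) (E : ℝ) : Set (Fin n) :=
  {u | ∃ (r : Route n) (a : Node n), IsRoute ω (Sum.inl u) r a ∧
    (∃ s : Street, s.level = 0 ∧ OnStreet ω s a) ∧
    energy Pmax δ ω r ≤ E ∧ (relays r).length ≤ k}

/-- The least number of hops of a route of accumulated energy at most `E` from user `u` to user `v`
(`⊤` if there is no such route). -/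
def minHops (Pmax δ : ℝ) (ω : Config n) (E : ℝ) (u v : Fin n) : ℕ∞ :=
  ⨅ r : {r : Route n // IsRoute ω (Sum.inl u) r (Sum.inl v) ∧ energy Pmax δ ω r ≤ E},
    (r.1.length : ℕ∞)

/-- The bound `minHops ≤ B` for a real number `B`. -/
def HopBound (Pmax δ : ℝ) (ω : Config n) (E B : ℝ) (u v : Fin n) : Prop :=
  (minHops Pmax δ ω E u v : ENNReal) ≤ ENNReal.ofReal B

/-- There is a diverted route from `u` to `v`, of accumulated energy at most `E` and with at most `B`
hops, whose fixed relays are exactly the following three: one where the street of `u` meets a street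
`s` of level `x`, one where `s` meets a street `t` of level `x`, one where `t` meets the street
of `v`. -/
def Diverted (Pmax δ : ℝ) (ω : Config n) (x : ℕ) (E B : ℝ) (u v : Fin n) : Prop :=
  ∃ (s t : Street) (a b c : Crossing) (r : Route n),
    s.level = x ∧ t.level = x ∧
    a.On (street ω u) ∧ a.On s ∧ b.On s ∧ b.On t ∧ c.On t ∧ c.On (street ω v) ∧
    IsRoute ω (Sum.inl u) r (Sum.inl v) ∧ relays r = [a, b, c] ∧
    energy Pmax δ ω r ≤ E ∧ (r.length : ℝ) ≤ B

/-- The energy budget `E_n = c_E n^{(1-δ)(1-α)} P_max`. -/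
def budget (Pmax δ α cE : ℝ) (n : ℕ) : ℝ := cE * (n : ℝ) ^ ((1 - δ) * (1 - α)) * Pmax

end Hyperfractal

end

/-!
Routes are built from walks along single streets: hopping from user to user joins two nodes of a
street in at most one hop more than there are users between them (`exists_walk`), so that a walk
along a street with `m` users costs at most about `P_max m^{1-δ}`.

Let `q = 1 - p` and let `x` be the integer part of `α log n / log (2/q)` lowered by a constant. A
street of level `x` carries about `A n^{1-α}` users with `A` as large as desired, hence a walk along
it, or along any street of lower level, costs at most an arbitrarily small fraction of the budget
`n^{(1-δ)(1-α)}`. The streets of level `x` meet every perpendicular street once in each dyadic cell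
of length `2^{-x}`, and `n 2^{-x}` is of order `n^{1-α/(d_F-1)}`: this is the number of hops needed to
reach the nearest street of level `x`, and it also bounds the number of users of a whole street of
level at least `x`. Finally `d_r < d_F - 1` means `((1-p_r)/2)^2 > q/2`, so that crossings of
streets of level at most `x` carry on average at least of order `n^{1-α}` auxiliary points, and all
have a relay. The structure `Regular` collects these properties of a realization.

On a regular realization, any two nodes on streets of level at most `x` are joined through at most
three streets of level `x` (`Regular.joined_of_level_le`), and two users on the two segments of the
central cross through exactly two, that is three relays (`Regular.diverted`). A user of `G_1` on a
street of level greater than `x` must by definition reach the central cross by a walk along its own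
street, which has few users (`Regular.exists_joined_of_mem_giant`). Two such walks within `θ E_n`
each leave `(1 - 2θ) E_n` for the rest, which gives the uniform statement. With the full budget
`E_n`, only pairs with a user of level greater than `x` can fail, and these users form a vanishing
proportion, whereas the central cross alone gives `G_1` a positive one
(`Regular.ncard_bad_pairs_le`, `tendsto_law_high_users`).

Regularity fails with vanishing probability (`tendsto_law_not_regular`) by a union bound over
polynomially many streets and crossings, with exponential tails for binomial counts
(`pi_le_ncard_mem_le`, `pi_ncard_mem_le_le`). The upper tail keeps a factor equal to the mass of the
region, so that the union bound over the infinitely many streets of high level converges.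
-/

namespace Hyperfractal

variable {n : ℕ}

/-! ### Routes and walks along one street -/

theorem Hop.symm {ω : Config n} {s : Street} {a b : Node n} (h : Hop ω s a b) : Hop ω s b a := by
  obtain ⟨ha, hb, hab, hi⟩ := h
  refine ⟨hb, ha, hab.symm, fun i his => ?_⟩
  rw [min_comm, max_comm]
  exact hi i his

theorem IsRoute.append {ω : Config n} {r₁ r₂ : Route n} {a b c : Node n}
    (h₁ : IsRoute ω a r₁ b) (h₂ : IsRoute ω b r₂ c) : IsRoute ω a (r₁ ++ r₂) c := by
  induction r₁ generalizing a with
  | nil => cases h₁; exact h₂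
  | cons h r ih => exact ⟨h₁.1, ih h₁.2⟩

@[simp] theorem energy_nil (Pmax δ : ℝ) (ω : Config n) : energy Pmax δ ω [] = 0 := rfl

@[simp] theorem energy_cons (Pmax δ : ℝ) (ω : Config n) (h : Street × Node n) (r : Route n) :
    energy Pmax δ ω (h :: r) = power Pmax δ ω h.1 + energy Pmax δ ω r := by
  simp [energy]

@[simp] theorem energy_append (Pmax δ : ℝ) (ω : Config n) (r₁ r₂ : Route n) :
    energy Pmax δ ω (r₁ ++ r₂) = energy Pmax δ ω r₁ + energy Pmax δ ω r₂ := by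
  simp [energy]

@[simp] theorem relays_append (r₁ r₂ : Route n) : relays (r₁ ++ r₂) = relays r₁ ++ relays r₂ := by
  simp [relays]

theorem power_nonneg {Pmax : ℝ} (hP : 0 < Pmax) (δ : ℝ) (ω : Config n) (s : Street) :
    0 ≤ power Pmax δ ω s := by
  unfold power
  positivity

theorem energy_nonneg {Pmax : ℝ} (hP : 0 < Pmax) (δ : ℝ) (ω : Config n) (r : Route n) :
    0 ≤ energy Pmax δ ω r := by
  induction r with
  | nil => simp
  | cons h r ih => rw [energy_cons]; exact add_nonneg (power_nonneg hP δ ω _) ih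

theorem energy_eq_of_forall {Pmax δ : ℝ} {ω : Config n} {s : Street} {r : Route n}
    (h : ∀ g ∈ r, g.1 = s) : energy Pmax δ ω r = r.length * power Pmax δ ω s := by
  induction r with
  | nil => simp
  | cons g r ih =>
    rw [energy_cons, ih fun g' hg' => h g' (List.mem_cons_of_mem _ hg'), h g List.mem_cons_self]
    push_cast [List.length_cons]
    ring

/-- A route can be travelled backwards, at the same cost and with the same number of hops. -/
theorem IsRoute.exists_reverse (Pmax δ : ℝ) {ω : Config n} {r : Route n} {a b : Node n}
    (h : IsRoute ω a r b) :
    ∃ r', IsRoute ω b r' a ∧ energy Pmax δ ω r' = energy Pmax δ ω r ∧ r'.length = r.length := by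
  induction r generalizing a with
  | nil => cases h; exact ⟨[], rfl, rfl, rfl⟩
  | cons g r ih =>
    obtain ⟨r', h', he, hl⟩ := ih h.2
    refine ⟨r' ++ [(g.1, a)], h'.append ⟨h.1.symm, rfl⟩, ?_, by simp [hl]⟩
    simp [he, add_comm]

/-- The users of the street `s` that stand strictly between the positions `y` and `z`. -/
def between (ω : Config n) (s : Street) (y z : ℝ) : Set (Fin n) :=
  {i | street ω i = s ∧ (ω.1 i).2 ∈ Set.Ioo (min y z) (max y z)}

theorem between_ncard_le_streetCount (ω : Config n) (s : Street) (y z : ℝ) :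
    (between ω s y z).ncard ≤ streetCount ω s :=
  Set.ncard_le_ncard (fun _ hi => hi.1) (Set.toFinite _)

/-- Hopping from user to user along a street joins any two distinct nodes of that street, and the
only relay reached on the way can be the last node. -/
theorem exists_walk (ω : Config n) (s : Street) {a b : Node n} (ha : OnStreet ω s a)
    (hb : OnStreet ω s b) (hab : a ≠ b) :
    ∃ r, IsRoute ω a r b ∧ (∀ g ∈ r, g.1 = s) ∧
      r.length ≤ (between ω s (pos ω s a) (pos ω s b)).ncard + 1 ∧
      relays r = b.getRight?.toList := by
  induction hm : (between ω s (pos ω s a) (pos ω s b)).ncard using Nat.strong_induction_on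
    generalizing a with
  | _ m ih =>
  by_cases hemp : between ω s (pos ω s a) (pos ω s b) = ∅
  · refine ⟨[(s, b)], ⟨⟨ha, hb, hab, fun i his hi => ?_⟩, rfl⟩, by simp, by simp, ?_⟩
    · have : i ∈ between ω s (pos ω s a) (pos ω s b) := ⟨his, hi⟩
      simp [hemp] at this
    · rcases b with b | b <;> simp [relays]
  · -- hop first to the nearest user strictly between the two nodes
    obtain ⟨w, hw, hmin⟩ := Set.exists_min_image (between ω s (pos ω s a) (pos ω s b))
      (fun i => |(ω.1 i).2 - pos ω s a|) (Set.toFinite _) (Set.nonempty_iff_ne_empty.2 hemp)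
    have hws : OnStreet ω s (Sum.inl w) := hw.1
    have hwpos : pos ω s (Sum.inl w : Node n) = (ω.1 w).2 := rfl
    have hne : ∀ c : Node n, (pos ω s c = pos ω s a ∨ pos ω s c = pos ω s b) → Sum.inl w ≠ c := by
      rintro c hc rfl
      have h1 := hw.2.1
      have h2 := hw.2.2
      rw [hwpos] at hc
      rcases hc with hc | hc <;> rw [hc] at h1 h2 <;>
        rcases le_total (pos ω s a) (pos ω s b) with h | h <;> simp [h] at h1 h2
    have hsub : between ω s (pos ω s (Sum.inl w : Node n)) (pos ω s b) ⊂
        between ω s (pos ω s a) (pos ω s b) := by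
      rw [Set.ssubset_iff_of_subset]
      · refine ⟨w, hw, fun hc => ?_⟩
        have h1 := hc.2.1
        have h2 := hc.2.2
        rw [hwpos] at h1 h2
        rcases le_total (ω.1 w).2 (pos ω s b) with h | h <;> simp [h] at h1 h2
      · rintro i ⟨his, h1, h2⟩
        refine ⟨his, lt_of_le_of_lt ?_ h1, lt_of_lt_of_le h2 ?_⟩
        · exact le_min hw.2.1.le (min_le_right _ _)
        · exact max_le hw.2.2.le (le_max_right _ _)
    have hlt := Set.ncard_lt_ncard hsub (Set.toFinite _)
    obtain ⟨r, hr, hrs, hrl, hrr⟩ := ih _ (hm ▸ hlt) hws (hne b (Or.inr rfl)) rfl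
    refine ⟨(s, Sum.inl w) :: r, ⟨⟨ha, hws, (hne a (Or.inl rfl)).symm, fun i his hi => ?_⟩, hr⟩,
      ?_, ?_, ?_⟩
    · have hi' : i ∈ between ω s (pos ω s a) (pos ω s b) := by
        refine ⟨his, lt_of_le_of_lt ?_ hi.1, lt_of_lt_of_le hi.2 ?_⟩
        · exact le_min (min_le_left _ _) hw.2.1.le
        · exact max_le (le_max_left _ _) hw.2.2.le
      have h3 := hmin i hi'
      have h1 := hi.1
      have h2 := hi.2
      rw [hwpos] at h1 h2
      rcases le_total (pos ω s a) (ω.1 w).2 with h | h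
      · simp only [h, min_eq_left, max_eq_right] at h1 h2
        rw [abs_of_nonneg (by linarith), abs_of_nonneg (by linarith)] at h3
        linarith
      · simp only [h, min_eq_right, max_eq_left] at h1 h2
        rw [abs_of_nonpos (by linarith), abs_of_nonpos (by linarith)] at h3
        linarith
    · intro g hg
      rcases List.mem_cons.1 hg with rfl | hg
      · rfl
      · exact hrs g hg
    · rw [List.length_cons]; omega
    · exact hrr

/-! ### Streets, crossings and the regularity event -/

/-- The crossing of two perpendicular streets. -/
def crossing (s t : Street) : Crossing :=
  if s.horizontal then ⟨s.line, t.line⟩ else ⟨t.line, s.line⟩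

theorem crossing_on_left (s t : Street) : (crossing s t).On s := by
  obtain ⟨o, l⟩ := s
  cases o <;> simp [crossing, Crossing.On]

theorem crossing_on_right {s t : Street} (h : t.horizontal = !s.horizontal) :
    (crossing s t).On t := by
  obtain ⟨o, l⟩ := s
  obtain ⟨o', l'⟩ := t
  cases o <;> simp_all [crossing, Crossing.On]

theorem crossing_pos_left (s t : Street) : (crossing s t).pos s = t.line.coord := by
  obtain ⟨o, l⟩ := s
  cases o <;> simp [crossing, Crossing.pos]

theorem Line.coord_mem (a : Line) : a.coord ∈ Set.Icc (0 : ℝ) 1 := by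
  have h : ((a.idx : ℕ) : ℝ) + 1 ≤ 2 ^ a.level := by exact_mod_cast a.idx.2
  unfold Line.coord
  refine ⟨by positivity, ?_⟩
  rw [div_le_one (by positivity), pow_succ]
  linarith

theorem Crossing.pos_mem (c : Crossing) (s : Street) : c.pos s ∈ Set.Icc (0 : ℝ) 1 := by
  unfold Crossing.pos
  split_ifs <;> exact Line.coord_mem _

/-- The `b`-th dyadic cell of length `2^{-x}`; its midpoint is the coordinate of the `b`-th line of
level `x`. -/
def cell (x b : ℕ) : Set ℝ := Set.Icc ((b : ℝ) / 2 ^ x) (((b : ℝ) + 1) / 2 ^ x)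

theorem exists_mem_cell (x : ℕ) {z : ℝ} (hz : z ∈ Set.Icc (0 : ℝ) 1) :
    ∃ b : Fin (2 ^ x), z ∈ cell x b := by
  have hpos : (0 : ℝ) < 2 ^ x := by positivity
  rcases hz.2.lt_or_eq with h | rfl
  · have h0 : 0 ≤ z * 2 ^ x := mul_nonneg hz.1 hpos.le
    refine ⟨⟨⌊z * 2 ^ x⌋₊, ?_⟩, ?_, ?_⟩
    · rw [Nat.floor_lt h0]
      push_cast
      nlinarith
    · rw [div_le_iff₀ hpos]; exact Nat.floor_le h0
    · rw [le_div_iff₀ hpos]; exact (Nat.lt_floor_add_one _).le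
  · have h1 : 1 ≤ 2 ^ x := Nat.one_le_two_pow
    refine ⟨⟨2 ^ x - 1, by omega⟩, ?_, ?_⟩
    · rw [div_le_one hpos]; push_cast [Nat.cast_sub h1]; linarith
    · rw [le_div_iff₀ hpos]; push_cast [Nat.cast_sub h1]; linarith

theorem coord_mem_cell (x : ℕ) (b : Fin (2 ^ x)) : Line.coord ⟨x, b⟩ ∈ cell x b := by
  have hpos : (0 : ℝ) < 2 ^ x := by positivity
  simp only [Line.coord, cell, pow_succ]
  constructor
  · rw [div_le_div_iff₀ hpos (by positivity)]; nlinarith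
  · rw [div_le_div_iff₀ (by positivity) hpos]; nlinarith

/-- The realizations on which all the routes of the theorem exist. Every crossing of streets of
level at most `x` carries a relay; a cell of length `2^{-x}` on any street, and the whole of a street
of level at least `x`, hold fewer than `k` users; and a walk along a street of level at most `x` that
visits each of its users at most once costs at most `e`. -/
structure Regular (Pmax δ : ℝ) (ω : Config n) (x k : ℕ) (e : ℝ) : Prop where
  relay : ∀ c : Crossing, c.row.level ≤ x → c.col.level ≤ x → 0 < ω.2 c
  unit : ∀ i, (ω.1 i).2 ∈ Set.Icc (0 : ℝ) 1
  local_count : ∀ s : Street, ∀ b : Fin (2 ^ x),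
    {i : Fin n | street ω i = s ∧ (ω.1 i).2 ∈ cell x b}.ncard < k
  thin : ∀ s : Street, x ≤ s.level → streetCount ω s < k
  cost : ∀ s : Street, s.level ≤ x → ((streetCount ω s : ℝ) + 1) * power Pmax δ ω s ≤ e

namespace Regular

variable {Pmax δ : ℝ} {ω : Config n} {x k : ℕ} {e : ℝ}

theorem pos_mem (h : Regular Pmax δ ω x k e) (s : Street) (a : Node n) :
    pos ω s a ∈ Set.Icc (0 : ℝ) 1 := by
  rcases a with i | c
  · exact h.unit i
  · exact c.pos_mem s

theorem cost_nonneg (hP : 0 < Pmax) (h : Regular Pmax δ ω x k e) : 0 ≤ e :=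
  le_trans (mul_nonneg (by positivity) (power_nonneg hP δ ω _))
    (h.cost ⟨true, ⟨0, 0⟩⟩ (Nat.zero_le _))

theorem onStreet_crossing (h : Regular Pmax δ ω x k e) {s t u : Street} (hs : s.level ≤ x)
    (ht : t.level ≤ x) (hu : (crossing s t).On u) : OnStreet ω u (Sum.inr (crossing s t)) := by
  refine ⟨h.relay _ ?_ ?_, hu⟩ <;> unfold crossing <;> split_ifs <;> assumption

theorem exists_walk (hP : 0 < Pmax) (h : Regular Pmax δ ω x k e) {s : Street} (hs : s.level ≤ x)
    {a b : Node n} (ha : OnStreet ω s a) (hb : OnStreet ω s b) (hab : a ≠ b)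
    (hk : (between ω s (pos ω s a) (pos ω s b)).ncard < k) :
    ∃ r, IsRoute ω a r b ∧ energy Pmax δ ω r ≤ e ∧ r.length ≤ k ∧
      relays r = b.getRight?.toList := by
  obtain ⟨r, hr, hrs, hrl, hrr⟩ := Hyperfractal.exists_walk ω s ha hb hab
  refine ⟨r, hr, ?_, hrl.trans hk, hrr⟩
  rw [energy_eq_of_forall hrs]
  refine le_trans (mul_le_mul_of_nonneg_right ?_ (power_nonneg hP δ ω s)) (h.cost s hs)
  have := between_ncard_le_streetCount ω s (pos ω s a) (pos ω s b)
  exact_mod_cast hrl.trans (by omega)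

/-- Near every point of a street there is a perpendicular street of level `x`. -/
theorem exists_near (h : Regular Pmax δ ω x k e) (s : Street) (a : Node n) :
    ∃ t : Street, t.level = x ∧ t.horizontal = !s.horizontal ∧
      (between ω s (pos ω s a) (pos ω s (Sum.inr (crossing s t) : Node n))).ncard < k := by
  obtain ⟨b, hb⟩ := exists_mem_cell x (h.pos_mem s a)
  refine ⟨⟨!s.horizontal, ⟨x, b⟩⟩, rfl, rfl, lt_of_le_of_lt ?_ (h.local_count s b)⟩
  have hc : pos ω s (Sum.inr (crossing s ⟨!s.horizontal, ⟨x, b⟩⟩) : Node n) ∈ cell x b := by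
    change (crossing s _).pos s ∈ _
    rw [crossing_pos_left]
    exact coord_mem_cell x b
  refine Set.ncard_le_ncard (fun i hi => ⟨hi.1, ?_⟩) (Set.toFinite _)
  exact ⟨(le_min hb.1 hc.1).trans hi.2.1.le, hi.2.2.le.trans (max_le hb.2 hc.2)⟩

end Regular

/-! ### Joining two nodes -/

/-- The nodes `a` and `b` are joined by a route of energy at most `e` with at most `m` hops. -/
def Joined (Pmax δ : ℝ) (ω : Config n) (e : ℝ) (m : ℕ) (a b : Node n) : Prop :=
  ∃ r, IsRoute ω a r b ∧ energy Pmax δ ω r ≤ e ∧ r.length ≤ m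

section Joined

variable {Pmax δ : ℝ} {ω : Config n} {e e₁ e₂ : ℝ} {m m₁ m₂ : ℕ} {a b c : Node n}

theorem Joined.refl (he : 0 ≤ e) (m : ℕ) (a : Node n) : Joined Pmax δ ω e m a a :=
  ⟨[], rfl, by simpa using he, by simp⟩

theorem Joined.symm (h : Joined Pmax δ ω e m a b) : Joined Pmax δ ω e m b a := by
  obtain ⟨r, hr, he, hm⟩ := h
  obtain ⟨r', hr', he', hm'⟩ := hr.exists_reverse Pmax δ
  exact ⟨r', hr', he'.trans_le he, hm'.trans_le hm⟩

theorem Joined.trans (h₁ : Joined Pmax δ ω e₁ m₁ a b) (h₂ : Joined Pmax δ ω e₂ m₂ b c) :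
    Joined Pmax δ ω (e₁ + e₂) (m₁ + m₂) a c := by
  obtain ⟨r₁, hr₁, he₁, hm₁⟩ := h₁
  obtain ⟨r₂, hr₂, he₂, hm₂⟩ := h₂
  refine ⟨r₁ ++ r₂, hr₁.append hr₂, ?_, ?_⟩
  · rw [energy_append]; exact add_le_add he₁ he₂
  · rw [List.length_append]; exact add_le_add hm₁ hm₂

theorem Joined.mono (h : Joined Pmax δ ω e₁ m₁ a b) (he : e₁ ≤ e₂) (hm : m₁ ≤ m₂) :
    Joined Pmax δ ω e₂ m₂ a b := by
  obtain ⟨r, hr, he', hm'⟩ := h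
  exact ⟨r, hr, he'.trans he, hm'.trans hm⟩

theorem Joined.hopBound {u v : Fin n} {B : ℝ}
    (h : Joined Pmax δ ω e m (Sum.inl u) (Sum.inl v)) (hB : (m : ℝ) ≤ B) :
    HopBound Pmax δ ω e B u v := by
  obtain ⟨r, hr, he, hm⟩ := h
  have h1 : minHops Pmax δ ω e u v ≤ (m : ℕ∞) :=
    (iInf_le (fun r : {r : Route n // IsRoute ω (Sum.inl u) r (Sum.inl v) ∧
      energy Pmax δ ω r ≤ e} => (r.1.length : ℕ∞)) ⟨r, hr, he⟩).trans (by exact_mod_cast hm)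
  unfold HopBound
  calc (minHops Pmax δ ω e u v : ENNReal) ≤ ((m : ℕ∞) : ENNReal) := by exact_mod_cast h1
    _ = ENNReal.ofReal m := by simp
    _ ≤ ENNReal.ofReal B := ENNReal.ofReal_le_ofReal hB

end Joined

namespace Regular

variable {Pmax δ : ℝ} {ω : Config n} {x k : ℕ} {e : ℝ}

theorem joined (hP : 0 < Pmax) (h : Regular Pmax δ ω x k e) {s : Street} (hs : s.level ≤ x)
    {a b : Node n} (ha : OnStreet ω s a) (hb : OnStreet ω s b)
    (hk : (between ω s (pos ω s a) (pos ω s b)).ncard < k) : Joined Pmax δ ω e k a b := by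
  by_cases hab : a = b
  · exact hab ▸ Joined.refl (h.cost_nonneg hP) _ _
  · obtain ⟨r, hr, he, hl, -⟩ := h.exists_walk hP hs ha hb hab hk
    exact ⟨r, hr, he, hl⟩

theorem between_lt (h : Regular Pmax δ ω x k e) {s : Street} (hs : s.level = x) (y z : ℝ) :
    (between ω s y z).ncard < k :=
  (between_ncard_le_streetCount ω s y z).trans_lt (h.thin s hs.ge)

/-- Two nodes standing on streets of level at most `x` are joined through at most three streets of
level `x`. -/
theorem joined_of_level_le (hP : 0 < Pmax) (h : Regular Pmax δ ω x k e) {s s' : Street}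
    (hs : s.level ≤ x) (hs' : s'.level ≤ x) {a b : Node n} (ha : OnStreet ω s a)
    (hb : OnStreet ω s' b) : Joined Pmax δ ω (5 * e) (5 * k) a b := by
  have he := h.cost_nonneg hP
  obtain ⟨t, htx, hts, htk⟩ := h.exists_near s a
  obtain ⟨t', htx', hts', htk'⟩ := h.exists_near s' b
  have hat : Joined Pmax δ ω e k a (Sum.inr (crossing s t)) :=
    h.joined hP hs ha (h.onStreet_crossing hs htx.le (crossing_on_left s t)) htk
  have hbt : Joined Pmax δ ω e k b (Sum.inr (crossing s' t')) :=
    h.joined hP hs' hb (h.onStreet_crossing hs' htx'.le (crossing_on_left s' t')) htk'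
  -- if `t` and `t'` are parallel, a street `w` of level `x` perpendicular to both links them
  have hmid : ∀ c d : Node n, OnStreet ω t c → OnStreet ω t' d →
      Joined Pmax δ ω (3 * e) (3 * k) c d := by
    intro c d hc hd
    by_cases ho : t'.horizontal = !t.horizontal
    · have h1 := h.onStreet_crossing htx.le htx'.le (crossing_on_left t t')
      have h2 := h.onStreet_crossing htx.le htx'.le (crossing_on_right ho)
      exact ((h.joined hP htx.le hc h1 (h.between_lt htx _ _)).trans
        (h.joined hP htx'.le h2 hd (h.between_lt htx' _ _))).mono (by linarith) (by omega)
    · set w : Street := ⟨!t.horizontal, t.line⟩ with hw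
      have hwx : w.level = x := htx
      have hwt' : w.horizontal = !t'.horizontal := by
        simp only [hw]
        cases h1 : t.horizontal <;> cases h2 : t'.horizontal <;> simp_all
      have h1 := h.onStreet_crossing htx.le hwx.le (crossing_on_left t w)
      have h2 := h.onStreet_crossing htx.le hwx.le (crossing_on_right (s := t) (t := w) rfl)
      have h3 := h.onStreet_crossing htx'.le hwx.le (crossing_on_left t' w)
      have h4 := h.onStreet_crossing htx'.le hwx.le (crossing_on_right hwt')
      exact (((h.joined hP htx.le hc h1 (h.between_lt htx _ _)).trans
        (h.joined hP hwx.le h2 h4 (h.between_lt hwx _ _))).trans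
        (h.joined hP htx'.le h3 hd (h.between_lt htx' _ _))).mono (by linarith) (by omega)
  exact ((hat.trans (hmid _ _ (h.onStreet_crossing hs htx.le (crossing_on_right hts))
    (h.onStreet_crossing hs' htx'.le (crossing_on_right hts')))).trans hbt.symm).mono
    (by linarith) (by omega)

/-- Two users standing on the two segments of the central cross are joined by a diverted route. -/
theorem diverted (hP : 0 < Pmax) (h : Regular Pmax δ ω x k e) (hx : 0 < x) {u v : Fin n}
    (hu : (street ω u).level = 0) (hv : (street ω v).level = 0)
    (huv : (street ω u).horizontal ≠ (street ω v).horizontal) {E B : ℝ} (hE : 4 * e ≤ E)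
    (hB : 4 * (k : ℝ) ≤ B) : Diverted Pmax δ ω x E B u v := by
  have hu' : (street ω u).level ≤ x := hu ▸ Nat.zero_le x
  have hv' : (street ω v).level ≤ x := hv ▸ Nat.zero_le x
  obtain ⟨s, hsx, hsu, hsk⟩ := h.exists_near (street ω u) (Sum.inl u)
  obtain ⟨t, htx, htv, htk⟩ := h.exists_near (street ω v) (Sum.inl v)
  have hst : t.horizontal = !s.horizontal := by
    rw [htv, hsu]
    cases h1 : (street ω u).horizontal <;> cases h2 : (street ω v).horizontal <;> simp_all
  set a := crossing (street ω u) s with hadef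
  set b := crossing s t with hbdef
  set c := crossing (street ω v) t with hcdef
  have ne_of_level : ∀ {S T V : Street}, S.level = 0 → T.level = x → V.level = x →
      T.horizontal = !S.horizontal → crossing S T ≠ crossing T V ∧ crossing S T ≠ crossing V T := by
    intro S T V hS hT hV hTS
    obtain ⟨o, l⟩ := S
    obtain ⟨o', l'⟩ := T
    obtain ⟨o'', l''⟩ := V
    simp only at hTS
    subst hTS
    simp only [Street.level] at hS hT hV
    constructor <;> intro heq <;> cases o <;> cases o'' <;> simp [crossing] at heq <;>
      first
        | (obtain ⟨h1, h2⟩ := heq; subst h1; omega)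
        | (obtain ⟨h1, h2⟩ := heq; subst h2; omega)
        | (subst heq; omega)
  have hab : (Sum.inr a : Node n) ≠ Sum.inr b := by
    rw [Ne, Sum.inr.injEq]; exact (ne_of_level hu hsx htx hsu).1
  have hbc : (Sum.inr b : Node n) ≠ Sum.inr c := by
    rw [Ne, Sum.inr.injEq]; exact ((ne_of_level hv htx hsx htv).2).symm
  have hau := h.onStreet_crossing hu' hsx.le (crossing_on_left (street ω u) s)
  have has := h.onStreet_crossing hu' hsx.le (crossing_on_right hsu)
  have hbs := h.onStreet_crossing hsx.le htx.le (crossing_on_left s t)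
  have hbt := h.onStreet_crossing hsx.le htx.le (crossing_on_right hst)
  have hct := h.onStreet_crossing hv' htx.le (crossing_on_right htv)
  have hcv := h.onStreet_crossing hv' htx.le (crossing_on_left (street ω v) t)
  obtain ⟨r₁, hr₁, he₁, hl₁, hc₁⟩ := h.exists_walk hP hu' (a := Sum.inl u) rfl hau (by simp) hsk
  obtain ⟨r₂, hr₂, he₂, hl₂, hc₂⟩ :=
    h.exists_walk hP hsx.le has hbs hab (h.between_lt hsx _ _)
  obtain ⟨r₃, hr₃, he₃, hl₃, hc₃⟩ :=
    h.exists_walk hP htx.le hbt hct hbc (h.between_lt htx _ _)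
  have htk' : (between ω (street ω v) (pos ω (street ω v) (Sum.inr c : Node n))
      (pos ω (street ω v) (Sum.inl v))).ncard < k := by
    have : ∀ y z, between ω (street ω v) y z = between ω (street ω v) z y := fun y z => by
      simp only [between, min_comm, max_comm]
    rw [this]
    exact htk
  obtain ⟨r₄, hr₄, he₄, hl₄, hc₄⟩ :=
    h.exists_walk hP hv' (b := Sum.inl v) hcv rfl (by simp) htk'
  refine ⟨s, t, a, b, c, r₁ ++ r₂ ++ r₃ ++ r₄, hsx, htx, hau.2, has.2, hbs.2, hbt.2, hct.2, hcv.2,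
    ((hr₁.append hr₂).append hr₃).append hr₄, ?_, ?_, ?_⟩
  · simp [hc₁, hc₂, hc₃, hc₄, hadef, hbdef, hcdef]
  · simp only [energy_append]; linarith
  · simp only [List.length_append]
    have : ((r₁.length + r₂.length + r₃.length + r₄.length : ℕ) : ℝ) ≤ ((4 * k : ℕ) : ℝ) := by
      exact_mod_cast (by omega)
    push_cast at this ⊢
    linarith

end Regular

/-! ### Users of the giant component -/

theorem onStreet_of_isRoute_of_relays_nil {ω : Config n} {r : Route n} {i : Fin n} {a : Node n}
    (h : IsRoute ω (Sum.inl i) r a) (hr : relays r = []) :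
    ∃ j, a = Sum.inl j ∧ street ω j = street ω i := by
  induction r generalizing i with
  | nil => exact ⟨i, Eq.symm h, rfl⟩
  | cons g r ih =>
    obtain ⟨s, b⟩ := g
    rcases b with j | c
    · obtain ⟨j', ha, hj'⟩ := ih h.2 (by simpa [relays] using hr)
      have h1 : street ω i = s := h.1.1
      have h2 : street ω j = s := h.1.2.1
      exact ⟨j', ha, hj'.trans (h2.trans h1.symm)⟩
    · simp [relays] at hr

/-- A route through at most one relay from a street off the central cross to the central cross
begins with a walk along that street to a relay of the central cross. -/
theorem exists_relay_of_isRoute {Pmax δ : ℝ} (hP : 0 < Pmax) {ω : Config n} {r : Route n}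
    {u : Fin n} {a : Node n} (h : IsRoute ω (Sum.inl u) r a) (hr : (relays r).length ≤ 1)
    (hu : (street ω u).level ≠ 0) (ha : ∃ s : Street, s.level = 0 ∧ OnStreet ω s a) :
    ∃ (c : Crossing) (r' : Route n), 0 < ω.2 c ∧ c.On (street ω u) ∧
      (∃ s : Street, s.level = 0 ∧ c.On s) ∧ IsRoute ω (Sum.inl u) r' (Sum.inr c) ∧
      (∀ g ∈ r', g.1 = street ω u) ∧ energy Pmax δ ω r' ≤ energy Pmax δ ω r := by
  induction r generalizing u with
  | nil =>
    obtain ⟨s, hs, has⟩ := ha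
    cases h
    have : street ω u = s := has
    exact absurd (this ▸ hs) hu
  | cons g r ih =>
    obtain ⟨s, b⟩ := g
    have h1 : street ω u = s := h.1.1
    rcases b with j | c
    · have h2 : street ω j = street ω u := (show street ω j = s from h.1.2.1).trans h1.symm
      obtain ⟨c, r', hc, hcu, hcs, hr', hall, he⟩ :=
        ih h.2 hr (h2 ▸ hu)
      refine ⟨c, (s, Sum.inl j) :: r', hc, h2 ▸ hcu, hcs, ⟨h.1, hr'⟩, ?_, ?_⟩
      · intro g hg
        rcases List.mem_cons.1 hg with rfl | hg
        · exact h1.symm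
        · exact (hall g hg).trans h2
      · simpa using he
    · refine ⟨c, [(s, Sum.inr c)], h.1.2.1.1, h1 ▸ h.1.2.1.2, ?_, ⟨h.1, rfl⟩, by simp [h1], ?_⟩
      · have hr0 : relays r = [] := by simpa [relays] using hr
        have h2 := h.2
        obtain ⟨s', hs', has'⟩ := ha
        rcases r with _ | ⟨⟨s'', b⟩, r⟩
        · cases h2
          exact ⟨s', hs', has'.2⟩
        · rcases b with j | d
          · obtain ⟨j', rfl, hj'⟩ :=
              onStreet_of_isRoute_of_relays_nil h2.2 (by simpa [relays] using hr0)
            have h3 : street ω j = s'' := h2.1.2.1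
            have h4 : street ω j' = s' := has'
            have h5 : s' = s'' := by rw [← h4, hj', h3]
            exact ⟨s', hs', h5 ▸ h2.1.1.2⟩
          · simp [relays] at hr0
      · simpa using energy_nonneg hP δ ω r

namespace Regular

variable {Pmax δ : ℝ} {ω : Config n} {x k : ℕ} {e : ℝ}

/-- A user of `G_1` reaches a street of level at most `x` in at most `k` hops within its energy
budget. -/
theorem exists_joined_of_mem_giant (hP : 0 < Pmax) (h : Regular Pmax δ ω x k e) {E : ℝ}
    (hE : 0 ≤ E) {u : Fin n} (hu : u ∈ giant Pmax δ ω 1 E) :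
    ∃ (a : Node n) (s : Street), s.level ≤ x ∧ OnStreet ω s a ∧
      Joined Pmax δ ω E k (Sum.inl u) a := by
  by_cases hux : (street ω u).level ≤ x
  · exact ⟨Sum.inl u, _, hux, rfl, Joined.refl hE _ _⟩
  push Not at hux
  obtain ⟨r, a, hr, ha, he, hl⟩ := hu
  obtain ⟨c, r', hc, hcu, ⟨s, hs, hcs⟩, hr', hall, he'⟩ :=
    exists_relay_of_isRoute (δ := δ) hP hr hl (by omega) ha
  refine ⟨Sum.inr c, s, hs ▸ Nat.zero_le x, ⟨hc, hcs⟩, ?_⟩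
  -- of this walk and of the direct one, the walk with fewer hops is both short and cheap
  obtain ⟨r'', hr'', hall'', hl'', -⟩ :=
    Hyperfractal.exists_walk ω (street ω u) (a := Sum.inl u) (b := Sum.inr c) rfl ⟨hc, hcu⟩ (by simp)
  have hk : r''.length ≤ k := hl''.trans
    ((between_ncard_le_streetCount ω _ _ _).trans_lt (h.thin _ hux.le))
  rcases le_total r''.length r'.length with hle | hle
  · refine ⟨r'', hr'', le_trans ?_ (he'.trans he), hk⟩
    rw [energy_eq_of_forall hall, energy_eq_of_forall hall'']
    exact mul_le_mul_of_nonneg_right (by exact_mod_cast hle) (power_nonneg hP δ ω _)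
  · exact ⟨r', hr', he'.trans he, hle.trans hk⟩

theorem hopBound_of_mem_giant (hP : 0 < Pmax) (h : Regular Pmax δ ω x k e) {E E' B : ℝ}
    (hE : 0 ≤ E) {u v : Fin n} (hu : u ∈ giant Pmax δ ω 1 E) (hv : v ∈ giant Pmax δ ω 1 E)
    (hE' : 2 * E + 5 * e ≤ E') (hB : 7 * (k : ℝ) ≤ B) : HopBound Pmax δ ω E' B u v := by
  obtain ⟨a, s, hs, has, hua⟩ := h.exists_joined_of_mem_giant hP hE hu
  obtain ⟨b, s', hs', hbs, hvb⟩ := h.exists_joined_of_mem_giant hP hE hv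
  refine (((hua.trans (h.joined_of_level_le hP hs hs' has hbs)).trans hvb.symm).mono
    (m₂ := 7 * k) (le_trans (by linarith) hE') (by omega)).hopBound (by push_cast; exact hB)

theorem hopBound_of_level_le (hP : 0 < Pmax) (h : Regular Pmax δ ω x k e) {E B : ℝ} {u v : Fin n}
    (hu : (street ω u).level ≤ x) (hv : (street ω v).level ≤ x) (hE : 5 * e ≤ E)
    (hB : 5 * (k : ℝ) ≤ B) : HopBound Pmax δ ω E B u v :=
  ((h.joined_of_level_le hP hu hv (a := Sum.inl u) (b := Sum.inl v) rfl rfl).mono hE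
    le_rfl).hopBound (by push_cast; exact hB)

end Regular

/-- Users of the central cross belong to every `G_k`. -/
theorem mem_giant_of_level_eq_zero {Pmax δ E : ℝ} {ω : Config n} (k : ℕ) (hE : 0 ≤ E) {u : Fin n}
    (hu : (street ω u).level = 0) : u ∈ giant Pmax δ ω k E :=
  ⟨[], Sum.inl u, rfl, ⟨_, hu, rfl⟩, by simpa using hE, by simp [relays]⟩

/-- Since only pairs with a user of level greater than `x` may fail the bound, few such users make
few bad pairs. -/
theorem Regular.ncard_bad_pairs_le {Pmax δ : ℝ} {ω : Config n} {x k : ℕ} {e : ℝ} (hP : 0 < Pmax)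
    (h : Regular Pmax δ ω x k e) {E B : ℝ} (hE : 5 * e ≤ E) (hB : 5 * (k : ℝ) ≤ B) :
    {uv : Fin n × Fin n | uv.1 ∈ giant Pmax δ ω 1 E ∧ uv.2 ∈ giant Pmax δ ω 1 E ∧
      ¬ HopBound Pmax δ ω E B uv.1 uv.2}.ncard ≤
    2 * (giant Pmax δ ω 1 E).ncard * {i : Fin n | x < (street ω i).level}.ncard := by
  set G := giant Pmax δ ω 1 E
  set H := {i : Fin n | x < (street ω i).level}
  calc _ ≤ (G ×ˢ H ∪ H ×ˢ G).ncard := by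
        refine Set.ncard_le_ncard (fun uv huv => ?_) (Set.toFinite _)
        obtain ⟨h1, h2, h3⟩ := huv
        by_contra hc
        simp only [Set.mem_union, Set.mem_prod, h1, h2, true_and, and_true, not_or, H,
          Set.mem_ofPred_eq, not_lt] at hc
        exact h3 (h.hopBound_of_level_le hP hc.2 hc.1 hE hB)
    _ ≤ (G ×ˢ H).ncard + (H ×ˢ G).ncard := Set.ncard_union_le _ _
    _ = 2 * G.ncard * H.ncard := by rw [Set.ncard_prod, Set.ncard_prod]; ring

end Hyperfractal

/-! ### Binomial tails -/

section BinomialTail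

variable {X : Type*} [MeasurableSpace X]

theorem measurable_ncard_mem {n : ℕ} {B : Set X} (hB : MeasurableSet B) :
    Measurable fun w : Fin n → X => {i | w i ∈ B}.ncard := by
  classical
  have : (fun w : Fin n → X => {i | w i ∈ B}.ncard) = fun w => ∑ i, if w i ∈ B then 1 else 0 := by
    funext w
    rw [Set.ncard_eq_toFinset_card', Finset.sum_boole]
    simp
  rw [this]
  exact Finset.measurable_sum _ fun i _ =>
    Measurable.ite (measurable_pi_apply i hB) measurable_const measurable_const

/-- The generating function of a binomial variable. -/
theorem lintegral_pow_ncard_mem (μ : Measure X) [IsProbabilityMeasure μ] (n : ℕ) {B : Set X}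
    (hB : MeasurableSet B) (c : ENNReal) :
    ∫⁻ w, c ^ {i | w i ∈ B}.ncard ∂(Measure.pi fun _ : Fin n => μ) = (c * μ B + μ Bᶜ) ^ n := by
  classical
  set f : X → ENNReal := fun a => if a ∈ B then c else 1 with hf
  have hfm : Measurable f := Measurable.ite hB measurable_const measurable_const
  have hprod : ∀ w : Fin n → X, c ^ {i | w i ∈ B}.ncard = ∏ i, f (w i) := by
    intro w
    simp only [hf]
    rw [Finset.prod_ite]
    simp [Set.ncard_eq_toFinset_card']
  have hint : ∫⁻ a, f a ∂μ = c * μ B + μ Bᶜ := by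
    rw [← lintegral_add_compl _ hB]
    congr 1
    · rw [setLIntegral_congr_fun hB (g := fun _ => c) (fun a ha => by simp [hf, ha])]
      simp
    · rw [setLIntegral_congr_fun hB.compl (g := fun _ => 1)
        (fun a ha => by simp [hf, (Set.mem_compl_iff _ _).1 ha])]
      simp
  have hind : ProbabilityTheory.iIndepFun (fun (i : Fin n) (w : Fin n → X) => f (w i))
      (Measure.pi fun _ : Fin n => μ) :=
    ProbabilityTheory.iIndepFun_pi (μ := fun _ : Fin n => μ) (X := fun _ => f)
      fun _ => hfm.aemeasurable
  simp_rw [hprod]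
  rw [ProbabilityTheory.lintegral_prod_eq_prod_lintegral_of_indepFun _
    (fun (i : Fin n) (w : Fin n → X) => f (w i)) hind
    (fun i => hfm.comp (measurable_pi_apply i))]
  have : ∀ i : Fin n, ∫⁻ w, f (w i) ∂(Measure.pi fun _ : Fin n => μ) = c * μ B + μ Bᶜ := by
    intro i
    rw [← hint]
    exact (measurePreserving_eval (fun _ : Fin n => μ) i).lintegral_comp hfm
  simp [this]

/-- Upper tail of a binomial variable, from its generating function at `2`. The factor `μ B`, which
comes from bounding the expectation of `2^N - 1` instead of that of `2^N`, makes the bound summable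
over disjoint regions. -/
theorem pi_le_ncard_mem_le (μ : Measure X) [IsProbabilityMeasure μ] {n k : ℕ} {B : Set X}
    (hB : MeasurableSet B) (hk : 1 ≤ k) (hBk : 4 * (n * μ.real B) ≤ k) :
    (Measure.pi fun _ : Fin n => μ) {w | k ≤ {i | w i ∈ B}.ncard} ≤
      ENNReal.ofReal (2 * n * Real.exp (-(k / 4))) * μ B := by
  set P := Measure.pi fun _ : Fin n => μ
  set A : Set (Fin n → X) := {w | k ≤ {i | w i ∈ B}.ncard} with hA
  have hAm : MeasurableSet A := measurable_ncard_mem hB measurableSet_Ici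
  set r := μ.real B with hr
  have hr0 : 0 ≤ r := measureReal_nonneg
  have hpow : (1 : ℝ) ≤ 2 ^ k := one_le_pow₀ (by norm_num)
  have hmain : 1 + ENNReal.ofReal (2 ^ k - 1) * P A ≤ (2 * μ B + μ Bᶜ) ^ n := by
    rw [← lintegral_pow_ncard_mem μ n hB 2]
    calc 1 + ENNReal.ofReal (2 ^ k - 1) * P A
        = ∫⁻ w, 1 + A.indicator (fun _ => ENNReal.ofReal (2 ^ k - 1)) w ∂P := by
          rw [lintegral_add_left measurable_const, lintegral_indicator_const hAm]
          simp
      _ ≤ _ := by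
          refine lintegral_mono fun w => ?_
          by_cases hw : w ∈ A
          · rw [Set.indicator_of_mem hw]
            calc (1 : ENNReal) + ENNReal.ofReal (2 ^ k - 1) = ENNReal.ofReal (1 + (2 ^ k - 1)) := by
                  rw [ENNReal.ofReal_add (by norm_num) (by linarith), ENNReal.ofReal_one]
              _ = 2 ^ k := by
                  rw [add_sub_cancel, ENNReal.ofReal_pow (by norm_num), ENNReal.ofReal_ofNat]
              _ ≤ _ := pow_le_pow_right₀ (by norm_num) hw
          · rw [Set.indicator_of_notMem hw, add_zero]
            exact one_le_pow₀ (by norm_num)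
  have hreal : 1 + (2 ^ k - 1) * P.real A ≤ (1 + r) ^ n := by
    have h2 : 2 * μ B + μ Bᶜ = ENNReal.ofReal (1 + r) := by
      rw [two_mul, add_assoc, prob_add_prob_compl hB, hr, add_comm (μ B),
        ENNReal.ofReal_add zero_le_one measureReal_nonneg, ofReal_measureReal, ENNReal.ofReal_one]
    rw [h2, ← ENNReal.ofReal_pow (by linarith), ← ofReal_measureReal (μ := P),
      ← ENNReal.ofReal_mul (by linarith), ← ENNReal.ofReal_one, ← ENNReal.ofReal_add (by norm_num)
      (mul_nonneg (by linarith) measureReal_nonneg)] at hmain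
    exact (ENNReal.ofReal_le_ofReal_iff (by positivity)).1 hmain
  have hnr : 0 ≤ n * r := by positivity
  have h3 : (1 + r) ^ n ≤ Real.exp (n * r) := by
    rw [Real.exp_nat_mul]
    exact pow_le_pow_left₀ (by linarith) (by linarith [Real.add_one_le_exp r]) n
  have h4 : Real.exp (n * r) - 1 ≤ n * r * Real.exp (n * r) := by
    have := Real.add_one_le_exp (-(n * r))
    have h5 : Real.exp (n * r) * Real.exp (-(n * r)) = 1 := by rw [← Real.exp_add]; simp
    nlinarith [Real.exp_pos (n * r)]
  -- `2 ≥ exp (1/2)`, so `2^k - 1 ≥ exp (k/2) / 2`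
  have h6 : Real.exp (k / 2) / 2 ≤ 2 ^ k - 1 := by
    have h7 : Real.exp (1 / 2) ≤ 2 := by
      have := Real.exp_one_lt_d9
      have h8 : Real.exp (1 / 2) * Real.exp (1 / 2) = Real.exp 1 := by rw [← Real.exp_add]; norm_num
      nlinarith [Real.exp_pos (1 / 2)]
    have h9 : Real.exp (k / 2) ≤ 2 ^ k := by
      calc Real.exp (k / 2) = Real.exp (1 / 2) ^ k := by rw [← Real.exp_nat_mul]; congr 1; ring
        _ ≤ 2 ^ k := pow_le_pow_left₀ (Real.exp_pos _).le h7 k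
    have h10 : (2 : ℝ) ≤ 2 ^ k := by
      calc (2 : ℝ) = 2 ^ 1 := by norm_num
        _ ≤ 2 ^ k := pow_le_pow_right₀ (by norm_num) hk
    linarith
  have h11 : Real.exp (k / 2) / 2 * P.real A ≤ n * r * Real.exp (k / 4) := by
    calc Real.exp (k / 2) / 2 * P.real A ≤ (2 ^ k - 1) * P.real A :=
          mul_le_mul_of_nonneg_right h6 measureReal_nonneg
      _ ≤ n * r * Real.exp (n * r) := by linarith
      _ ≤ n * r * Real.exp (k / 4) :=
          mul_le_mul_of_nonneg_left (Real.exp_le_exp.2 (by linarith)) hnr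
  have h12 : P.real A ≤ 2 * n * Real.exp (-(k / 4)) * r := by
    have e1 : Real.exp (k / 2 : ℝ) = Real.exp (k / 4) * Real.exp (k / 4) := by
      rw [← Real.exp_add]; congr 1; ring
    have e2 : Real.exp (k / 4 : ℝ) * Real.exp (-(k / 4)) = 1 := by rw [← Real.exp_add]; simp
    have e3 := Real.exp_pos (k / 4 : ℝ)
    rw [e1] at h11
    have h13 : Real.exp (k / 4 : ℝ) * P.real A ≤ 2 * n * r := by nlinarith
    calc P.real A = Real.exp (k / 4 : ℝ) * P.real A * Real.exp (-(k / 4)) := by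
          rw [mul_right_comm, e2, one_mul]
      _ ≤ 2 * n * r * Real.exp (-(k / 4)) := mul_le_mul_of_nonneg_right h13 (Real.exp_pos _).le
      _ = _ := by ring
  rw [← ofReal_measureReal (μ := P), ← ofReal_measureReal (μ := μ),
    ← ENNReal.ofReal_mul (by positivity)]
  exact ENNReal.ofReal_le_ofReal h12

/-- Lower tail of a binomial variable, from its generating function at `1/2`. -/
theorem pi_ncard_mem_le_le (μ : Measure X) [IsProbabilityMeasure μ] {n : ℕ} {B : Set X}
    (hB : MeasurableSet B) {r : ℝ} (hr : r ≤ μ.real B) :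
    (Measure.pi fun _ : Fin n => μ) {w | ({i | w i ∈ B}.ncard : ℝ) ≤ n * r / 4} ≤
      ENNReal.ofReal (Real.exp (-(n * r / 4))) := by
  set P := Measure.pi fun _ : Fin n => μ
  set s := n * r / 4 with hs
  have h1 := mul_meas_ge_le_lintegral (μ := P)
    (f := fun w => (ENNReal.ofReal (1 / 2)) ^ {i | w i ∈ B}.ncard)
    ((measurable_from_nat (f := fun m => (ENNReal.ofReal (1 / 2)) ^ m)).comp
      (measurable_ncard_mem hB)) (ENNReal.ofReal (Real.exp (-s)))
  rw [lintegral_pow_ncard_mem μ n hB] at h1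
  have hsub : {w : Fin n → X | ({i | w i ∈ B}.ncard : ℝ) ≤ s} ⊆
      {w | ENNReal.ofReal (Real.exp (-s)) ≤ (ENNReal.ofReal (1 / 2)) ^ {i | w i ∈ B}.ncard} := by
    intro w hw
    simp only [Set.mem_ofPred_eq] at hw ⊢
    rw [← ENNReal.ofReal_pow (by norm_num)]
    apply ENNReal.ofReal_le_ofReal
    have h2 : Real.exp (-1) ≤ 1 / 2 := by
      have := Real.add_one_le_exp (1 : ℝ)
      rw [Real.exp_neg, one_div]
      exact inv_anti₀ (by norm_num) (by linarith)
    calc Real.exp (-s) ≤ Real.exp (({i | w i ∈ B}.ncard : ℝ) * (-1)) :=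
          Real.exp_le_exp.2 (by linarith)
      _ = Real.exp (-1) ^ {i | w i ∈ B}.ncard := Real.exp_nat_mul _ _
      _ ≤ _ := pow_le_pow_left₀ (Real.exp_pos _).le h2 _
  have h3 : (ENNReal.ofReal (1 / 2) * μ B + μ Bᶜ) ^ n ≤ ENNReal.ofReal (Real.exp (-(2 * s))) := by
    have h4 : ENNReal.ofReal (1 / 2) * μ B + μ Bᶜ = ENNReal.ofReal (1 - μ.real B / 2) := by
      rw [← ofReal_measureReal (μ := μ) (s := B), ← ofReal_measureReal (μ := μ) (s := Bᶜ),
        ← ENNReal.ofReal_mul (by norm_num), probReal_compl_eq_one_sub hB,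
        ← ENNReal.ofReal_add (by positivity) (by linarith [measureReal_le_one (μ := μ) (s := B)])]
      congr 1
      ring
    have h5 : 0 ≤ 1 - μ.real B / 2 := by linarith [measureReal_le_one (μ := μ) (s := B)]
    rw [h4, ← ENNReal.ofReal_pow h5]
    apply ENNReal.ofReal_le_ofReal
    calc (1 - μ.real B / 2) ^ n ≤ Real.exp (-(r / 2)) ^ n :=
          pow_le_pow_left₀ h5 (by linarith [Real.add_one_le_exp (-(r / 2))]) n
      _ = Real.exp (-(2 * s)) := by rw [← Real.exp_nat_mul]; congr 1; rw [hs]; ring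
  have h6 : ENNReal.ofReal (Real.exp (-s)) * P {w | ({i | w i ∈ B}.ncard : ℝ) ≤ s} ≤
      ENNReal.ofReal (Real.exp (-s)) * ENNReal.ofReal (Real.exp (-s)) := by
    refine (mul_le_mul_right (measure_mono hsub) _).trans (h1.trans (h3.trans_eq ?_))
    rw [← ENNReal.ofReal_mul (Real.exp_pos _).le, ← Real.exp_add]
    congr 2
    ring
  exact (ENNReal.mul_le_mul_iff_right (by simp [Real.exp_pos]) ENNReal.ofReal_ne_top).1 h6

end BinomialTail

namespace Hyperfractal

/-! ### The law of one user -/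

/-- A line is a level together with an index at that level. -/
def lineEquiv : Line ≃ Σ l : ℕ, Fin (2 ^ l) where
  toFun a := ⟨a.level, a.idx⟩
  invFun a := ⟨a.1, a.2⟩

/-- A street is a direction together with a line. -/
def streetEquiv : Street ≃ Bool × Line where
  toFun s := (s.horizontal, s.line)
  invFun s := ⟨s.1, s.2⟩

/-- A crossing is a pair of lines. -/
def crossingEquiv : Crossing ≃ Line × Line where
  toFun c := (c.row, c.col)
  invFun c := ⟨c.1, c.2⟩

instance : Countable Line := lineEquiv.countable_iff.2 inferInstance

instance : Countable Street := streetEquiv.countable_iff.2 inferInstance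

/-- The probability that a user stands on a given street of level `l`. -/
noncomputable def mass (p : ℝ) (l : ℕ) : ℝ := p * (1 - p) ^ l / 2 ^ (l + 1)

theorem mass_nonneg {p : ℝ} (hp0 : 0 < p) (hp1 : p < 1) (l : ℕ) : 0 ≤ mass p l := by
  have : 0 < 1 - p := by linarith
  unfold mass
  positivity

theorem mass_anti {p : ℝ} (hp0 : 0 < p) (hp1 : p < 1) : Antitone (mass p) := by
  have hq : 0 < 1 - p := by linarith
  refine antitone_nat_of_succ_le fun l => ?_
  have h := mass_nonneg hp0 hp1 l
  have : mass p (l + 1) = mass p l * ((1 - p) / 2) := by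
    unfold mass
    rw [pow_succ (1 - p), pow_succ 2 (l + 1)]
    field_simp
  rw [this]
  exact mul_le_of_le_one_right h (by linarith)

theorem mass_le {p : ℝ} (hp0 : 0 < p) (hp1 : p < 1) (l : ℕ) : mass p l ≤ 1 / 2 ^ l := by
  have hq : 0 < 1 - p := by linarith
  have h1 : p * (1 - p) ^ l ≤ 1 :=
    mul_le_one₀ hp1.le (by positivity) (pow_le_one₀ hq.le (by linarith))
  unfold mass
  rw [div_le_div_iff₀ (by positivity) (by positivity), pow_succ]
  have : (0 : ℝ) < 2 ^ l := by positivity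
  nlinarith

theorem tsum_mass {p : ℝ} (hp0 : 0 < p) (hp1 : p < 1) :
    ∑' s : Street, ENNReal.ofReal (mass p s.level) = 1 := by
  have hq : 0 < 1 - p := by linarith
  have h1 : ∑' s : Street, ENNReal.ofReal (mass p s.level) =
      ∑' a : Bool × Σ l : ℕ, Fin (2 ^ l), ENNReal.ofReal (mass p a.2.1) :=
    (streetEquiv.trans ((Equiv.refl Bool).prodCongr lineEquiv)).tsum_eq
      fun a : Bool × Σ l : ℕ, Fin (2 ^ l) => ENNReal.ofReal (mass p a.2.1)
  have h2 : ∀ l : ℕ, ∑' _ : Fin (2 ^ l), ENNReal.ofReal (mass p l) =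
      ENNReal.ofReal (p / 2) * ENNReal.ofReal (1 - p) ^ l := by
    intro l
    rw [tsum_fintype, Finset.sum_const, Finset.card_univ, Fintype.card_fin, nsmul_eq_mul,
      ← ENNReal.ofReal_natCast, ← ENNReal.ofReal_mul (by positivity),
      ← ENNReal.ofReal_pow hq.le, ← ENNReal.ofReal_mul (by positivity)]
    congr 1
    unfold mass
    push_cast
    rw [pow_succ]
    field_simp
  have h3 : ∑' b : Σ l : ℕ, Fin (2 ^ l), ENNReal.ofReal (mass p b.1) = ENNReal.ofReal (1 / 2) := by
    rw [ENNReal.tsum_sigma fun (l : ℕ) (_ : Fin (2 ^ l)) => ENNReal.ofReal (mass p l)]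
    simp_rw [h2]
    rw [ENNReal.tsum_mul_left, ENNReal.tsum_geometric]
    have h4 : (1 : ENNReal) - ENNReal.ofReal (1 - p) = ENNReal.ofReal p := by
      rw [← ENNReal.ofReal_one, ← ENNReal.ofReal_sub _ hq.le]
      congr 1
      ring
    rw [h4, ← ENNReal.ofReal_inv_of_pos hp0, ← ENNReal.ofReal_mul (by positivity)]
    congr 1
    field_simp
  rw [h1, ENNReal.tsum_prod' (f := fun a : Bool × Σ l : ℕ, Fin (2 ^ l) =>
    ENNReal.ofReal (mass p a.2.1))]
  simp only [h3]
  rw [tsum_fintype, Fintype.sum_bool, ← ENNReal.ofReal_add (by norm_num) (by norm_num)]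
  norm_num

/-- The law of the street of one user. -/
noncomputable def streetLaw (p : ℝ) : Measure Street :=
  Measure.sum fun s : Street => ENNReal.ofReal (mass p s.level) • Measure.dirac s

theorem userLaw_eq (p : ℝ) :
    userLaw p = (streetLaw p).prod (volume.restrict (Set.Icc (0 : ℝ) 1)) := rfl

theorem streetLaw_singleton (p : ℝ) (s : Street) :
    streetLaw p {s} = ENNReal.ofReal (mass p s.level) := by
  have hs : MeasurableSet ({s} : Set Street) := trivial
  rw [streetLaw, Measure.sum_apply _ hs, tsum_eq_single s]
  · simp
  · intro t ht
    simp [ht]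

theorem isProbabilityMeasure_streetLaw {p : ℝ} (hp0 : 0 < p) (hp1 : p < 1) :
    IsProbabilityMeasure (streetLaw p) := by
  refine ⟨?_⟩
  rw [streetLaw, Measure.sum_apply _ MeasurableSet.univ]
  simpa using tsum_mass hp0 hp1

instance : IsProbabilityMeasure (volume.restrict (Set.Icc (0 : ℝ) 1)) := ⟨by simp⟩

theorem isProbabilityMeasure_userLaw {p : ℝ} (hp0 : 0 < p) (hp1 : p < 1) :
    IsProbabilityMeasure (userLaw p) := by
  have := isProbabilityMeasure_streetLaw hp0 hp1
  rw [userLaw_eq]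
  infer_instance

theorem userLaw_street {p : ℝ} (s : Street) :
    userLaw p {a | a.1 = s} = ENNReal.ofReal (mass p s.level) := by
  have : {a : Street × ℝ | a.1 = s} = {s} ×ˢ Set.univ := by ext; simp
  rw [this, userLaw_eq, Measure.prod_prod, measure_univ, mul_one, streetLaw_singleton]

theorem volume_cell (x b : ℕ) : volume (cell x b) = ENNReal.ofReal (1 / 2 ^ x) := by
  rw [cell, Real.volume_Icc]
  congr 1
  ring

theorem userLaw_cell_le {p : ℝ} (s : Street) (x b : ℕ) :
    userLaw p {a | a.1 = s ∧ a.2 ∈ cell x b} ≤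
      ENNReal.ofReal (mass p s.level) * ENNReal.ofReal (1 / 2 ^ x) := by
  have : {a : Street × ℝ | a.1 = s ∧ a.2 ∈ cell x b} = {s} ×ˢ cell x b := by ext; simp
  rw [this, userLaw_eq, Measure.prod_prod, streetLaw_singleton]
  exact mul_le_mul_right ((Measure.restrict_apply_le _ _).trans_eq (volume_cell x b)) _

theorem measurableSet_fst_mem (A : Set Street) : MeasurableSet {a : Street × ℝ | a.1 ∈ A} :=
  measurable_fst (show MeasurableSet A from trivial)

theorem measurableSet_cell (s : Street) (x b : ℕ) :
    MeasurableSet {a : Street × ℝ | a.1 = s ∧ a.2 ∈ cell x b} :=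
  (measurableSet_fst_mem {s}).inter (measurable_snd measurableSet_Icc)

/-- The proportion of users of high level vanishes. -/
theorem tendsto_userLaw_level_gt {p : ℝ} (hp0 : 0 < p) (hp1 : p < 1) :
    Tendsto (fun x : ℕ => (userLaw p).real {a | x < a.1.level}) atTop (𝓝 0) := by
  have := isProbabilityMeasure_userLaw hp0 hp1
  have h : Tendsto (fun x : ℕ => userLaw p {a | x < a.1.level}) atTop
      (𝓝 (userLaw p (⋂ x : ℕ, {a : Street × ℝ | x < a.1.level}))) :=
    tendsto_measure_iInter_atTop
      (fun x => (measurableSet_fst_mem {s : Street | x < s.level}).nullMeasurableSet)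
      (fun x y hxy a ha => lt_of_le_of_lt hxy ha) ⟨0, measure_ne_top _ _⟩
  have h0 : (⋂ x : ℕ, {a : Street × ℝ | x < a.1.level}) = ∅ := by
    ext a
    simp only [Set.mem_iInter, Set.mem_ofPred_eq, Set.mem_empty_iff_false, iff_false, not_forall,
      not_lt]
    exact ⟨_, le_rfl⟩
  rw [h0, measure_empty] at h
  exact (ENNReal.tendsto_toReal ENNReal.zero_ne_top).comp h

/-! ### Probabilities of the exceptional events -/

section Events

variable {p : ℝ} (pr ρ : ℝ) {n : ℕ}

/-- The law of the users is a product measure, whatever the relays. -/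
theorem law_fst_eq (A : (Fin n → Street × ℝ) → Prop) :
    law p pr ρ n {ω | A ω.1} = (Measure.pi fun _ : Fin n => userLaw p) {w | A w} := by
  have : {ω : Config n | A ω.1} = {w | A w} ×ˢ Set.univ := by ext; simp
  rw [this, law, Measure.prod_prod, measure_univ, mul_one]

theorem law_unit (hp0 : 0 < p) (hp1 : p < 1) :
    law p pr ρ n {ω | ∃ i, (ω.1 i).2 ∉ Set.Icc (0 : ℝ) 1} = 0 := by
  have := isProbabilityMeasure_userLaw hp0 hp1
  have h1 : law p pr ρ n {ω | ∃ i, (ω.1 i).2 ∉ Set.Icc (0 : ℝ) 1} =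
      (Measure.pi fun _ : Fin n => userLaw p) {w | ∃ i, (w i).2 ∉ Set.Icc (0 : ℝ) 1} :=
    law_fst_eq pr ρ fun w => ∃ i, (w i).2 ∉ Set.Icc (0 : ℝ) 1
  have h2 : {w : Fin n → Street × ℝ | ∃ i, (w i).2 ∉ Set.Icc (0 : ℝ) 1} =
      ⋃ i, {w | (w i).2 ∉ Set.Icc (0 : ℝ) 1} := by ext; simp
  rw [h1, h2]
  refine measure_iUnion_null fun i => ?_
  have hm : MeasurableSet {a : Street × ℝ | a.2 ∉ Set.Icc (0 : ℝ) 1} :=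
    measurable_snd measurableSet_Icc.compl
  rw [show {w : Fin n → Street × ℝ | (w i).2 ∉ Set.Icc (0 : ℝ) 1} =
    Function.eval i ⁻¹' {a : Street × ℝ | a.2 ∉ Set.Icc (0 : ℝ) 1} from rfl,
    (measurePreserving_eval (fun _ : Fin n => userLaw p) i).measure_preimage hm.nullMeasurableSet]
  have h3 : {a : Street × ℝ | a.2 ∉ Set.Icc (0 : ℝ) 1} = Set.univ ×ˢ (Set.Icc (0 : ℝ) 1)ᶜ := by
    ext; simp
  rw [h3, userLaw_eq, Measure.prod_prod, Measure.restrict_apply measurableSet_Icc.compl]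
  simp

/-- Union bound for a countable family of regions of total mass at most `1`. -/
theorem law_exists_le_ncard_le (hp0 : 0 < p) (hp1 : p < 1) {ι : Type*} [Countable ι] {k : ℕ}
    {B : ι → Set (Street × ℝ)} (hB : ∀ j, MeasurableSet (B j)) (hk : 1 ≤ k)
    (hBk : ∀ j, 4 * (n * (userLaw p).real (B j)) ≤ k) (hsum : ∑' j, userLaw p (B j) ≤ 1) :
    law p pr ρ n {ω | ∃ j, k ≤ {i | ω.1 i ∈ B j}.ncard} ≤
      ENNReal.ofReal (2 * n * Real.exp (-(k / 4))) := by
  have := isProbabilityMeasure_userLaw hp0 hp1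
  have h1 : law p pr ρ n {ω | ∃ j, k ≤ {i | ω.1 i ∈ B j}.ncard} =
      (Measure.pi fun _ : Fin n => userLaw p) {w | ∃ j, k ≤ {i | w i ∈ B j}.ncard} :=
    law_fst_eq pr ρ fun w => ∃ j, k ≤ {i | w i ∈ B j}.ncard
  have h2 : {w : Fin n → Street × ℝ | ∃ j, k ≤ {i | w i ∈ B j}.ncard} =
      ⋃ j, {w | k ≤ {i | w i ∈ B j}.ncard} := by ext; simp
  rw [h1, h2]
  calc _ ≤ ∑' j, (Measure.pi fun _ : Fin n => userLaw p) {w | k ≤ {i | w i ∈ B j}.ncard} :=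
        measure_iUnion_le _
    _ ≤ ∑' j, ENNReal.ofReal (2 * n * Real.exp (-(k / 4))) * userLaw p (B j) :=
        ENNReal.tsum_le_tsum fun j => pi_le_ncard_mem_le _ (hB j) hk (hBk j)
    _ = ENNReal.ofReal (2 * n * Real.exp (-(k / 4))) * ∑' j, userLaw p (B j) :=
        ENNReal.tsum_mul_left
    _ ≤ ENNReal.ofReal (2 * n * Real.exp (-(k / 4))) * 1 := mul_le_mul_right hsum _
    _ = _ := mul_one _

theorem law_local_count_le (hp0 : 0 < p) (hp1 : p < 1) {x k : ℕ} (hk : 1 ≤ k)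
    (hxk : 4 * (n * (1 / 2 ^ x : ℝ)) ≤ k) :
    law p pr ρ n {ω | ∃ (s : Street) (b : Fin (2 ^ x)),
      k ≤ {i : Fin n | street ω i = s ∧ (ω.1 i).2 ∈ cell x b}.ncard} ≤
      ENNReal.ofReal (2 * n * Real.exp (-(k / 4))) := by
  have := isProbabilityMeasure_userLaw hp0 hp1
  refine le_trans (measure_mono ?_) (law_exists_le_ncard_le pr ρ hp0 hp1 (ι := Street × Fin (2 ^ x))
    (B := fun j => {a | a.1 = j.1 ∧ a.2 ∈ cell x j.2}) (fun j => measurableSet_cell _ _ _) hk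
    (fun j => le_trans ?_ hxk) ?_)
  · rintro ω ⟨s, b, h⟩
    exact ⟨(s, b), h⟩
  · gcongr
    refine ENNReal.toReal_le_of_le_ofReal (by positivity) ((userLaw_cell_le j.1 x j.2).trans ?_)
    have h1 : ENNReal.ofReal (mass p j.1.level) ≤ 1 := by
      rw [← userLaw_street]
      exact prob_le_one
    exact (mul_le_mul_left h1 _).trans_eq (one_mul _)
  · calc _ ≤ ∑' j : Street × Fin (2 ^ x),
          ENNReal.ofReal (mass p j.1.level) * ENNReal.ofReal (1 / 2 ^ x) :=
          ENNReal.tsum_le_tsum fun j => userLaw_cell_le _ _ _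
      _ = ∑' s : Street, ∑' _ : Fin (2 ^ x),
          ENNReal.ofReal (mass p s.level) * ENNReal.ofReal (1 / 2 ^ x) :=
          ENNReal.tsum_prod (f := fun (s : Street) (_ : Fin (2 ^ x)) =>
            ENNReal.ofReal (mass p s.level) * ENNReal.ofReal (1 / 2 ^ x))
      _ = ∑' s : Street, ENNReal.ofReal (mass p s.level) := by
          congr 1
          funext s
          rw [tsum_fintype, Finset.sum_const, Finset.card_univ, Fintype.card_fin, nsmul_eq_mul,
            mul_left_comm, ← ENNReal.ofReal_natCast, ← ENNReal.ofReal_mul (by positivity)]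
          push_cast
          rw [mul_one_div_cancel (by positivity)]
          simp
      _ ≤ 1 := (tsum_mass hp0 hp1).le

theorem law_thin_le (hp0 : 0 < p) (hp1 : p < 1) {x k : ℕ} (hk : 1 ≤ k)
    (hxk : 4 * (n * (1 / 2 ^ x : ℝ)) ≤ k) :
    law p pr ρ n {ω | ∃ s : Street, x ≤ s.level ∧ k ≤ streetCount ω s} ≤
      ENNReal.ofReal (2 * n * Real.exp (-(k / 4))) := by
  have := isProbabilityMeasure_userLaw hp0 hp1
  refine le_trans (measure_mono ?_) (law_exists_le_ncard_le pr ρ hp0 hp1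
    (ι := {s : Street // x ≤ s.level}) (B := fun j => {a | a.1 = j.1})
    (fun j => measurableSet_fst_mem {j.1}) hk (fun j => le_trans ?_ hxk) ?_)
  · rintro ω ⟨s, hs, h⟩
    exact ⟨⟨s, hs⟩, h⟩
  · gcongr
    refine ENNReal.toReal_le_of_le_ofReal (by positivity) ((userLaw_street j.1).trans_le ?_)
    exact ENNReal.ofReal_le_ofReal (((mass_anti hp0 hp1) j.2).trans (mass_le hp0 hp1 x))
  · calc _ = ∑' j : {s : Street // x ≤ s.level}, ENNReal.ofReal (mass p j.1.level) := by
          simp only [userLaw_street]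
      _ ≤ ∑' s : Street, ENNReal.ofReal (mass p s.level) :=
          ENNReal.tsum_comp_le_tsum_of_injective Subtype.val_injective
            (fun s : Street => ENNReal.ofReal (mass p s.level))
      _ ≤ 1 := (tsum_mass hp0 hp1).le

theorem law_level_gt_le (hp0 : 0 < p) (hp1 : p < 1) {x k : ℕ} (hk : 1 ≤ k)
    (hxk : 4 * (n * (userLaw p).real {a | x < a.1.level}) ≤ k) :
    law p pr ρ n {ω | k ≤ {i : Fin n | x < (street ω i).level}.ncard} ≤
      ENNReal.ofReal (2 * n * Real.exp (-(k / 4))) := by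
  have := isProbabilityMeasure_userLaw hp0 hp1
  refine le_trans (measure_mono ?_) (law_exists_le_ncard_le pr ρ hp0 hp1 (ι := Unit)
    (B := fun _ => {a | x < a.1.level})
    (fun _ => measurableSet_fst_mem {s : Street | x < s.level}) hk (fun _ => hxk) ?_)
  · intro ω h
    exact ⟨(), h⟩
  · rw [tsum_fintype]
    simpa using prob_le_one

/-- The lines of level at most `x`. -/
def lowLines (x : ℕ) : Finset Line :=
  ((Finset.range (x + 1)).sigma fun l => (Finset.univ : Finset (Fin (2 ^ l)))).map
    lineEquiv.symm.toEmbedding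

theorem mem_lowLines {x : ℕ} (a : Line) (ha : a.level ≤ x) : a ∈ lowLines x := by
  rw [lowLines, Finset.mem_map]
  refine ⟨lineEquiv a, ?_, lineEquiv.symm_apply_apply a⟩
  simp only [Finset.mem_sigma, Finset.mem_range, Finset.mem_univ, and_true]
  exact Nat.lt_succ_of_le ha

theorem level_le_of_mem_lowLines {x : ℕ} {a : Line} (ha : a ∈ lowLines x) : a.level ≤ x := by
  rw [lowLines, Finset.mem_map] at ha
  obtain ⟨b, hb, rfl⟩ := ha
  simp only [Finset.mem_sigma, Finset.mem_range, Finset.mem_univ, and_true] at hb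
  exact Nat.le_of_lt_succ hb

theorem card_lowLines_le (x : ℕ) : (lowLines x).card ≤ 2 ^ (x + 1) := by
  rw [lowLines, Finset.card_map, Finset.card_sigma]
  simp only [Finset.card_univ, Fintype.card_fin]
  exact (Nat.geomSum_lt le_rfl fun i hi => Finset.mem_range.1 hi).le

theorem law_streetCount_le (hp0 : 0 < p) (hp1 : p < 1) (x : ℕ) :
    law p pr ρ n {ω | ∃ s : Street, s.level ≤ x ∧ (streetCount ω s : ℝ) ≤ n * mass p x / 4} ≤
      ENNReal.ofReal (2 ^ (x + 2) * Real.exp (-(n * mass p x / 4))) := by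
  have := isProbabilityMeasure_userLaw hp0 hp1
  set F : Finset (Bool × Line) := Finset.univ ×ˢ lowLines x with hF
  have hsub : {ω : Config n |
      ∃ s : Street, s.level ≤ x ∧ (streetCount ω s : ℝ) ≤ n * mass p x / 4} ⊆
      ⋃ a ∈ F, {ω | ({i | ω.1 i ∈ {c : Street × ℝ | c.1 = streetEquiv.symm a}}.ncard : ℝ) ≤
          n * mass p x / 4} := by
    rintro ω ⟨s, hs, h⟩
    simp only [Set.mem_iUnion]
    refine ⟨streetEquiv s, ?_, ?_⟩
    · rw [hF, Finset.mem_product]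
      exact ⟨Finset.mem_univ _, mem_lowLines _ hs⟩
    · simpa [streetCount, street] using h
  refine (measure_mono hsub).trans ((measure_biUnion_finset_le _ _).trans ?_)
  calc _ ≤ ∑ a ∈ F, ENNReal.ofReal (Real.exp (-(n * mass p x / 4))) := by
        refine Finset.sum_le_sum fun a ha => ?_
        rw [law_fst_eq pr ρ fun w => ({i | w i ∈ {c : Street × ℝ |
          c.1 = streetEquiv.symm a}}.ncard : ℝ) ≤ n * mass p x / 4]
        refine pi_ncard_mem_le_le _ (measurableSet_fst_mem {streetEquiv.symm a}) ?_
        rw [Measure.real, show {c : Street × ℝ | c.1 ∈ ({streetEquiv.symm a} : Set Street)} =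
          {c | c.1 = streetEquiv.symm a} from rfl, userLaw_street,
          ENNReal.toReal_ofReal (mass_nonneg hp0 hp1 _)]
        exact mass_anti hp0 hp1 (level_le_of_mem_lowLines (Finset.mem_product.1 ha).2)
    _ ≤ _ := by
        rw [Finset.sum_const, nsmul_eq_mul, ← ENNReal.ofReal_natCast,
          ← ENNReal.ofReal_mul (by positivity)]
        apply ENNReal.ofReal_le_ofReal
        gcongr
        have h1 : F.card ≤ 2 ^ (x + 2) := by
          rw [hF, Finset.card_product, Finset.card_univ, Fintype.card_bool]
          calc 2 * (lowLines x).card ≤ 2 * 2 ^ (x + 1) := by gcongr; exact card_lowLines_le x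
            _ = 2 ^ (x + 2) := by ring
        exact_mod_cast h1

theorem law_no_relay_eq (hp0 : 0 < p) (hp1 : p < 1) (c : Crossing) :
    law p pr ρ n {ω | ω.2 c = 0} = ENNReal.ofReal (Real.exp (-(relayMean pr ρ c : ℝ))) := by
  have := isProbabilityMeasure_userLaw hp0 hp1
  have hm : MeasurableSet ({0} : Set ℕ) := trivial
  have : {ω : Config n | ω.2 c = 0} = Set.univ ×ˢ (Function.eval c ⁻¹' {0}) := by ext; simp
  rw [this, law, Measure.prod_prod, measure_univ, one_mul,
    (measurePreserving_eval_infinitePi (fun c : Crossing =>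
      ProbabilityTheory.poissonMeasure (relayMean pr ρ c)) c).measure_preimage
      hm.nullMeasurableSet, ProbabilityTheory.poissonMeasure_singleton]
  simp

theorem law_relay_le (hp0 : 0 < p) (hp1 : p < 1) {pr ρ : ℝ} (hpr0 : 0 < pr) (hpr1 : pr < 1)
    (hρ : 0 ≤ ρ) (x : ℕ) :
    law p pr ρ n {ω | ∃ c : Crossing, c.row.level ≤ x ∧ c.col.level ≤ x ∧ ω.2 c = 0} ≤
      ENNReal.ofReal ((2 ^ (x + 1)) ^ 2 *
        Real.exp (-(ρ * (pr ^ 2 * ((1 - pr) / 2) ^ (2 * x))))) := by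
  set F : Finset (Line × Line) := lowLines x ×ˢ lowLines x with hF
  have hsub : {ω : Config n | ∃ c : Crossing, c.row.level ≤ x ∧ c.col.level ≤ x ∧ ω.2 c = 0} ⊆
      ⋃ a ∈ F, {ω | ω.2 (crossingEquiv.symm a) = 0} := by
    rintro ω ⟨c, hr, hc, h⟩
    simp only [Set.mem_iUnion]
    refine ⟨crossingEquiv c, ?_, ?_⟩
    · rw [hF, Finset.mem_product]
      exact ⟨mem_lowLines _ hr, mem_lowLines _ hc⟩
    · simpa using h
  refine (measure_mono hsub).trans ((measure_biUnion_finset_le _ _).trans ?_)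
  calc _ ≤ ∑ a ∈ F, ENNReal.ofReal
        (Real.exp (-(ρ * (pr ^ 2 * ((1 - pr) / 2) ^ (2 * x))))) := by
        refine Finset.sum_le_sum fun a ha => ?_
        rw [law_no_relay_eq pr ρ hp0 hp1]
        apply ENNReal.ofReal_le_ofReal
        rw [Real.exp_le_exp, neg_le_neg_iff, relayMean]
        refine le_trans ?_ (Real.le_coe_toNNReal _)
        have hb0 : 0 ≤ (1 - pr) / 2 := by linarith
        have h1 := level_le_of_mem_lowLines (Finset.mem_product.1 ha).1
        have h2 := level_le_of_mem_lowLines (Finset.mem_product.1 ha).2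
        refine mul_le_mul_of_nonneg_left (mul_le_mul_of_nonneg_left
          (pow_le_pow_of_le_one hb0 (by linarith) ?_) (by positivity)) hρ
        change a.1.level + a.2.level ≤ 2 * x
        omega
    _ ≤ _ := by
        rw [Finset.sum_const, nsmul_eq_mul, ← ENNReal.ofReal_natCast,
          ← ENNReal.ofReal_mul (by positivity)]
        apply ENNReal.ofReal_le_ofReal
        gcongr
        have h1 : F.card ≤ (2 ^ (x + 1)) ^ 2 := by
          rw [hF, Finset.card_product, sq]
          exact Nat.mul_le_mul (card_lowLines_le x) (card_lowLines_le x)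
        exact_mod_cast h1

end Events

/-! ### The level of the diverting streets -/

theorem userDim_sub_one {p : ℝ} (hp1 : p < 1) :
    userDim p - 1 = Real.log (2 / (1 - p)) / Real.log 2 := by
  have hq : 0 < 1 - p := by linarith
  have h2 : 0 < Real.log 2 := Real.log_pos (by norm_num)
  have : Real.log (4 / (1 - p)) = Real.log 2 + Real.log (2 / (1 - p)) := by
    rw [← Real.log_mul (by norm_num) (by positivity)]
    congr 1
    ring
  rw [userDim, this]
  field_simp
  ring

/-- The condition on the dimensions in multiplicative form. -/
theorem half_le_sq_of_relayDim_lt {p pr : ℝ} (hp1 : p < 1) (hpr1 : pr < 1)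
    (h : relayDim pr < userDim p - 1) : (1 - p) / 2 ≤ ((1 - pr) / 2) ^ 2 := by
  have hq : 0 < 1 - p := by linarith
  have hb : 0 < 1 - pr := by linarith
  have h2 : 0 < Real.log 2 := Real.log_pos (by norm_num)
  rw [userDim_sub_one hp1, relayDim, ← mul_div_assoc, div_lt_div_iff_of_pos_right h2] at h
  have h3 : (2 / (1 - pr)) ^ 2 ≤ 2 / (1 - p) := by
    rw [← Real.log_le_log_iff (by positivity) (by positivity), Real.log_pow]
    exact_mod_cast h.le
  have h4 := inv_anti₀ (by positivity) h3
  rwa [inv_div, ← inv_pow, inv_div] at h4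

theorem mass_eq (p : ℝ) (l : ℕ) : mass p l = p / 2 * ((1 - p) / 2) ^ l := by
  rw [mass, div_pow, pow_succ]
  field_simp

/-- The level of the diverting streets; the shift `m` gives these streets enough users to make them
cheap. -/
noncomputable def divertLevel (p α : ℝ) (m n : ℕ) : ℕ :=
  ⌊α * Real.log n / Real.log (2 / (1 - p))⌋₊ - m

/-- A number that bounds the users of every cell of length `2^{-x}` and of every street of level at
least `x`, for `x` the level of the diverting streets. It is at least four times `n 2^{-x}`, which
bounds the expected number of users in such a region, for the binomial tail to be small, and it is
positive. -/
noncomputable def cellBound (p α : ℝ) (m n : ℕ) : ℕ :=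
  ⌈4 * (n * (1 / 2 ^ divertLevel p α m n : ℝ))⌉₊ + 1

section Level

variable {p α : ℝ}

theorem log_two_div_pos (hp0 : 0 < p) (hp1 : p < 1) : 0 < Real.log (2 / (1 - p)) := by
  have hq : 0 < 1 - p := by linarith
  exact Real.log_pos (by rw [lt_div_iff₀ hq]; linarith)

theorem le_divertLevel (p α : ℝ) (m n : ℕ) :
    α * Real.log n / Real.log (2 / (1 - p)) - 1 - m ≤ divertLevel p α m n := by
  have h1 := Nat.lt_floor_add_one (α * Real.log n / Real.log (2 / (1 - p)))
  have h2 : (⌊α * Real.log n / Real.log (2 / (1 - p))⌋₊ : ℝ) ≤ divertLevel p α m n + m := by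
    unfold divertLevel
    exact_mod_cast (by omega)
  linarith

theorem abs_divertLevel_sub_le (hp0 : 0 < p) (hp1 : p < 1) (hα0 : 0 < α) (m n : ℕ) :
    |(divertLevel p α m n : ℝ) - α * Real.log n / Real.log (2 / (1 - p))| ≤ m + 1 := by
  have h0 : 0 ≤ α * Real.log n / Real.log (2 / (1 - p)) :=
    div_nonneg (mul_nonneg hα0.le (Real.log_natCast_nonneg n)) (log_two_div_pos hp0 hp1).le
  have h1 := le_divertLevel p α m n
  have h2 := Nat.floor_le h0
  have h3 : (divertLevel p α m n : ℝ) ≤ ⌊α * Real.log n / Real.log (2 / (1 - p))⌋₊ := by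
    unfold divertLevel
    exact_mod_cast Nat.sub_le _ _
  rw [abs_le]
  constructor <;> linarith [(Nat.cast_nonneg m : (0 : ℝ) ≤ m)]

theorem tendsto_log_div (hp0 : 0 < p) (hp1 : p < 1) (hα0 : 0 < α) :
    Tendsto (fun n : ℕ => α * Real.log n / Real.log (2 / (1 - p))) atTop atTop :=
  ((Real.tendsto_log_atTop.comp tendsto_natCast_atTop_atTop).const_mul_atTop hα0).atTop_div_const
    (log_two_div_pos hp0 hp1)

theorem tendsto_divertLevel (hp0 : 0 < p) (hp1 : p < 1) (hα0 : 0 < α) (m : ℕ) :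
    Tendsto (divertLevel p α m) atTop atTop := by
  rw [← tendsto_natCast_atTop_iff (R := ℝ)]
  refine tendsto_atTop_mono (fun n => le_divertLevel p α m n) ?_
  have := tendsto_atTop_add_const_right atTop (-1 - (m : ℝ)) (tendsto_log_div hp0 hp1 hα0)
  refine this.congr fun n => ?_
  ring

theorem eventually_pow_divertLevel_le (hp0 : 0 < p) (hp1 : p < 1) (hα0 : 0 < α) (m : ℕ) :
    ∀ᶠ n : ℕ in atTop,
      (2 / (1 - p)) ^ m * (2 / (1 - p)) ^ divertLevel p α m n ≤ (n : ℝ) ^ α := by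
  have hq : 0 < 1 - p := by linarith
  have hL := log_two_div_pos hp0 hp1
  filter_upwards [(tendsto_log_div hp0 hp1 hα0).eventually_ge_atTop (m : ℝ),
    eventually_ge_atTop 1] with n hn hn1
  have h0 : (0 : ℝ) ≤ α * Real.log n / Real.log (2 / (1 - p)) := le_trans (by positivity) hn
  have h1 : m ≤ ⌊α * Real.log n / Real.log (2 / (1 - p))⌋₊ := Nat.le_floor hn
  rw [← pow_add, divertLevel, Nat.add_sub_cancel' h1, ← Real.log_le_log_iff (by positivity)
    (by positivity), Real.log_pow, Real.log_rpow (by positivity)]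
  calc _ ≤ α * Real.log n / Real.log (2 / (1 - p)) * Real.log (2 / (1 - p)) :=
        mul_le_mul_of_nonneg_right (Nat.floor_le h0) hL.le
    _ = α * Real.log n := div_mul_cancel₀ _ hL.ne'

theorem div_two_pow_divertLevel_le (hp1 : p < 1) (m : ℕ) {n : ℕ} (hn : 1 ≤ n) :
    (n : ℝ) * (1 / 2 ^ divertLevel p α m n) ≤
      2 ^ (m + 1) * (n : ℝ) ^ (1 - α / (userDim p - 1)) := by
  have hn0 : (0 : ℝ) < n := by positivity
  have h2 : 0 < Real.log 2 := Real.log_pos (by norm_num)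
  rw [Real.rpow_sub hn0, Real.rpow_one, mul_one_div, mul_div_left_comm]
  rw [div_eq_mul_inv]
  refine mul_le_mul_of_nonneg_left ?_ hn0.le
  rw [inv_le_iff_one_le_mul₀ (by positivity), div_mul_eq_mul_div, one_le_div (by positivity),
    ← Real.log_le_log_iff (by positivity) (by positivity), Real.log_rpow hn0, ← pow_add,
    Real.log_pow, userDim_sub_one hp1]
  have h1 := le_divertLevel p α m n
  calc _ = α * Real.log n / Real.log (2 / (1 - p)) * Real.log 2 := by
        rw [div_div_eq_mul_div]; ring
    _ ≤ _ := by
        refine mul_le_mul_of_nonneg_right ?_ h2.le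
        push_cast
        linarith

theorem cellBound_le (hp1 : p < 1) (hdF : 3 < userDim p) (hα1 : α < 1) (m : ℕ)
    {n : ℕ} (hn : 1 ≤ n) :
    7 * (cellBound p α m n : ℝ) ≤
      7 * (2 ^ (m + 3) + 2) * (n : ℝ) ^ (1 - α / (userDim p - 1)) := by
  have h1 := div_two_pow_divertLevel_le (α := α) hp1 m hn
  have h2 : (1 : ℝ) ≤ (n : ℝ) ^ (1 - α / (userDim p - 1)) := by
    refine Real.one_le_rpow (by exact_mod_cast hn) ?_
    rw [sub_nonneg, div_le_one (by linarith)]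
    linarith
  have h3 := Nat.ceil_lt_add_one
    (show (0 : ℝ) ≤ 4 * (n * (1 / 2 ^ divertLevel p α m n : ℝ)) by positivity)
  unfold cellBound
  push_cast at h3 ⊢
  have h4 : (2 : ℝ) ^ (m + 3) = 4 * 2 ^ (m + 1) := by ring
  rw [h4]
  nlinarith

end Level

/-! ### Regularity holds with high probability -/

theorem tendsto_sq_mul_exp_neg {α c : ℝ} (hα1 : α < 1) (hc : 0 < c) :
    Tendsto (fun n : ℕ => (n : ℝ) ^ 2 * Real.exp (-c * (n : ℝ) ^ (1 - α))) atTop (𝓝 0) := by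
  have hα : 0 < 1 - α := by linarith
  have h := (tendsto_rpow_mul_exp_neg_mul_atTop_nhds_zero (2 / (1 - α)) c hc).comp
    ((tendsto_rpow_atTop hα).comp tendsto_natCast_atTop_atTop)
  refine h.congr fun n => ?_
  simp only [Function.comp]
  rw [← Real.rpow_mul (Nat.cast_nonneg n), mul_div_cancel₀ _ hα.ne', Real.rpow_ofNat]

/-- A street with at least `A n^{1-α}` users costs at most a multiple `2/A` of the budget. -/
theorem cost_le {Pmax δ α A : ℝ} (hP : 0 < Pmax) (hδ : 2 ≤ δ) (hα1 : α < 1)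
    (hA : 1 ≤ A) {n : ℕ} (hn : 1 ≤ n) {ω : Config n} {s : Street}
    (hs : A * (n : ℝ) ^ (1 - α) ≤ streetCount ω s) :
    ((streetCount ω s : ℝ) + 1) * power Pmax δ ω s ≤
      2 / A * (n : ℝ) ^ ((1 - δ) * (1 - α)) * Pmax := by
  have hn1 : (1 : ℝ) ≤ n := by exact_mod_cast hn
  have hN : 1 ≤ (n : ℝ) ^ (1 - α) := Real.one_le_rpow hn1 (by linarith)
  have hN0 : 0 < (n : ℝ) ^ (1 - α) := by linarith
  set M := (streetCount ω s : ℝ) with hM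
  have hAN : 1 ≤ A * (n : ℝ) ^ (1 - α) := one_le_mul_of_one_le_of_one_le hA hN
  have hM1 : 1 ≤ M := hAN.trans hs
  have hM0 : 0 < M := by linarith
  have hpow : M ^ (1 - δ) ≤ A⁻¹ * (n : ℝ) ^ ((1 - δ) * (1 - α)) := by
    calc M ^ (1 - δ) ≤ (A * (n : ℝ) ^ (1 - α)) ^ (1 - δ) :=
          Real.rpow_le_rpow_of_nonpos (by linarith) hs (by linarith)
      _ = A ^ (1 - δ) * (n : ℝ) ^ ((1 - δ) * (1 - α)) := by
          rw [Real.mul_rpow (by linarith) hN0.le, ← Real.rpow_mul (by linarith), mul_comm (1 - α)]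
      _ ≤ A⁻¹ * (n : ℝ) ^ ((1 - δ) * (1 - α)) := by
          refine mul_le_mul_of_nonneg_right ?_ (by positivity)
          rw [← Real.rpow_neg_one]
          exact Real.rpow_le_rpow_of_exponent_le hA (by linarith)
  have hMd : M ^ (1 - δ) = M / M ^ δ := by rw [Real.rpow_sub hM0, Real.rpow_one]
  have hMd0 : 0 < M ^ δ := Real.rpow_pos_of_pos hM0 δ
  unfold power
  rw [← hM, max_eq_left hM1]
  calc (M + 1) * (Pmax / M ^ δ) ≤ (2 * M) * (Pmax / M ^ δ) :=
        mul_le_mul_of_nonneg_right (by linarith) (by positivity)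
    _ = 2 * (M / M ^ δ) * Pmax := by ring
    _ ≤ 2 * (A⁻¹ * (n : ℝ) ^ ((1 - δ) * (1 - α))) * Pmax := by
        rw [← hMd]
        gcongr
    _ = _ := by ring

theorem tendsto_law_not_regular {p pr α δ Pmax A : ℝ} (hp0 : 0 < p) (hp1 : p < 1) (hpr0 : 0 < pr)
    (hpr1 : pr < 1) (hdr : relayDim pr < userDim p - 1) (hδ : 2 ≤ δ) (hα0 : 0 < α) (hα1 : α < 1)
    (hP : 0 < Pmax) (hA : 1 ≤ A) {m : ℕ} (hm : A ≤ p / 8 * (2 / (1 - p)) ^ m) :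
    Tendsto (fun n : ℕ => law p pr n n {ω | ¬ Regular Pmax δ ω (divertLevel p α m n)
      (cellBound p α m n) (2 / A * (n : ℝ) ^ ((1 - δ) * (1 - α)) * Pmax)}) atTop (𝓝 0) := by
  have hq : 0 < 1 - p := by linarith
  have hlim : Tendsto (fun n : ℕ => ENNReal.ofReal
      (12 * ((n : ℝ) ^ 2 * Real.exp (-pr ^ 2 * (n : ℝ) ^ (1 - α))))) atTop (𝓝 0) := by
    have h := (tendsto_sq_mul_exp_neg hα1 (c := pr ^ 2) (by positivity)).const_mul 12
    rw [mul_zero] at h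
    simpa only [ENNReal.ofReal_zero] using ENNReal.tendsto_ofReal h
  refine tendsto_of_tendsto_of_tendsto_of_le_of_le' tendsto_const_nhds hlim
    (Eventually.of_forall fun _ => zero_le) ?_
  filter_upwards [eventually_pow_divertLevel_le hp0 hp1 hα0 m, eventually_ge_atTop 1] with n hpow hn
  set x := divertLevel p α m n with hx
  set k := cellBound p α m n with hk
  set N := (n : ℝ) ^ (1 - α) with hN
  have hn1 : (1 : ℝ) ≤ n := by exact_mod_cast hn
  have hn0 : (0 : ℝ) < n := by linarith
  have hN0 : 0 < N := Real.rpow_pos_of_pos hn0 _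
  have hNα : N * (n : ℝ) ^ α = n := by rw [hN, ← Real.rpow_add hn0]; simp
  have h2q : 2 ≤ 2 / (1 - p) := by rw [le_div_iff₀ hq]; nlinarith
  have hone : 1 ≤ (2 / (1 - p)) ^ m := one_le_pow₀ (by linarith)
  have hpow' : (2 / (1 - p)) ^ x ≤ (n : ℝ) ^ α :=
    le_trans (le_mul_of_one_le_left (by positivity) hone) hpow
  have h2x : (2 : ℝ) ^ x ≤ (n : ℝ) ^ α := (pow_le_pow_left₀ (by norm_num) h2q x).trans hpow'
  have hαn : (n : ℝ) ^ α ≤ n := by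
    simpa using Real.rpow_le_rpow_of_exponent_le hn1 hα1.le
  have h2n : (2 : ℝ) ^ x ≤ n := h2x.trans hαn
  have hprod : ((1 - p) / 2) ^ x * (2 / (1 - p)) ^ x = 1 := by
    rw [← mul_pow, div_mul_div_comm, mul_comm (1 - p), div_self (by positivity), one_pow]
  have hpr2 : pr ^ 2 ≤ 1 := pow_le_one₀ hpr0.le hpr1.le
  -- the three exponents that appear in the union bound
  have hmass : A * N ≤ n * mass p x / 4 := by
    have h1 : (2 / (1 - p)) ^ m * N ≤ n * ((1 - p) / 2) ^ x := by
      calc (2 / (1 - p)) ^ m * N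
          = ((2 / (1 - p)) ^ m * (2 / (1 - p)) ^ x) * (N * ((1 - p) / 2) ^ x) := by
            linear_combination (-((2 / (1 - p)) ^ m * N)) * hprod
        _ ≤ (n : ℝ) ^ α * (N * ((1 - p) / 2) ^ x) :=
            mul_le_mul_of_nonneg_right hpow (by positivity)
        _ = n * ((1 - p) / 2) ^ x := by linear_combination ((1 - p) / 2) ^ x * hNα
    rw [mass_eq]
    calc A * N ≤ p / 8 * (2 / (1 - p)) ^ m * N := mul_le_mul_of_nonneg_right hm hN0.le
      _ = p / 8 * ((2 / (1 - p)) ^ m * N) := by ring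
      _ ≤ p / 8 * (n * ((1 - p) / 2) ^ x) := mul_le_mul_of_nonneg_left h1 (by positivity)
      _ = _ := by ring
  have hrel : pr ^ 2 * N ≤ n * (pr ^ 2 * ((1 - pr) / 2) ^ (2 * x)) := by
    have h1 : ((1 - p) / 2) ^ x ≤ ((1 - pr) / 2) ^ (2 * x) := by
      rw [pow_mul]
      exact pow_le_pow_left₀ (by positivity) (half_le_sq_of_relayDim_lt hp1 hpr1 hdr) x
    have h2 : N ≤ n * ((1 - p) / 2) ^ x := by
      calc N = (2 / (1 - p)) ^ x * (N * ((1 - p) / 2) ^ x) := by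
            linear_combination (-N) * hprod
        _ ≤ (n : ℝ) ^ α * (N * ((1 - p) / 2) ^ x) :=
            mul_le_mul_of_nonneg_right hpow' (by positivity)
        _ = n * ((1 - p) / 2) ^ x := by linear_combination ((1 - p) / 2) ^ x * hNα
    have h3 : N ≤ n * ((1 - pr) / 2) ^ (2 * x) :=
      h2.trans (mul_le_mul_of_nonneg_left h1 hn0.le)
    calc pr ^ 2 * N ≤ pr ^ 2 * (n * ((1 - pr) / 2) ^ (2 * x)) :=
          mul_le_mul_of_nonneg_left h3 (by positivity)
      _ = _ := by ring
  have hxk : 4 * (n * (1 / 2 ^ x : ℝ)) ≤ k := by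
    refine (Nat.le_ceil _).trans ?_
    rw [hk, cellBound]
    push_cast
    linarith
  have hkN : N ≤ k / 4 := by
    have h1 : N ≤ n * (1 / 2 ^ x : ℝ) := by
      rw [mul_one_div, le_div_iff₀ (by positivity)]
      calc N * 2 ^ x ≤ N * (n : ℝ) ^ α := mul_le_mul_of_nonneg_left h2x hN0.le
        _ = n := hNα
    linarith
  have hk1 : 1 ≤ k := by rw [hk, cellBound]; omega
  -- the union bound
  have hsub : {ω : Config n | ¬ Regular Pmax δ ω x k
      (2 / A * (n : ℝ) ^ ((1 - δ) * (1 - α)) * Pmax)} ⊆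
      {ω | ∃ c : Crossing, c.row.level ≤ x ∧ c.col.level ≤ x ∧ ω.2 c = 0} ∪
      ({ω | ∃ i, (ω.1 i).2 ∉ Set.Icc (0 : ℝ) 1} ∪
      ({ω | ∃ (s : Street) (b : Fin (2 ^ x)),
        k ≤ {i : Fin n | street ω i = s ∧ (ω.1 i).2 ∈ cell x b}.ncard} ∪
      ({ω | ∃ s : Street, x ≤ s.level ∧ k ≤ streetCount ω s} ∪
      {ω | ∃ s : Street, s.level ≤ x ∧ (streetCount ω s : ℝ) ≤ n * mass p x / 4}))) := by
    intro ω hω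
    by_contra hc
    simp only [Set.mem_union, Set.mem_ofPred_eq, not_or, not_exists, not_and, not_le,
      not_not] at hc
    obtain ⟨h1, h2, h3, h4, h5⟩ := hc
    exact hω ⟨fun c hr hc => Nat.pos_of_ne_zero (h1 c hr hc), h2, h3, h4,
      fun s hs => cost_le hP hδ hα1 hA hn (hmass.trans (h5 s hs).le)⟩
  set b := (n : ℝ) ^ 2 * Real.exp (-pr ^ 2 * N) with hb
  have hexp : ∀ y : ℝ, N ≤ y → Real.exp (-y) ≤ Real.exp (-pr ^ 2 * N) := fun y hy =>
    Real.exp_le_exp.2 (by nlinarith)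
  have hsq : (n : ℝ) ≤ (n : ℝ) ^ 2 := by nlinarith
  have e1 : (2 ^ (x + 1)) ^ 2 * Real.exp (-(n * (pr ^ 2 * ((1 - pr) / 2) ^ (2 * x)))) ≤ 4 * b := by
    have h1 : ((2 : ℝ) ^ (x + 1)) ^ 2 ≤ 4 * (n : ℝ) ^ 2 := by
      rw [pow_succ 2 x, mul_pow]
      nlinarith [pow_le_pow_left₀ (by positivity) h2n 2]
    calc _ ≤ 4 * (n : ℝ) ^ 2 * Real.exp (-pr ^ 2 * N) :=
          mul_le_mul h1 (Real.exp_le_exp.2 (by linarith)) (Real.exp_pos _).le (by positivity)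
      _ = 4 * b := by rw [hb]; ring
  have e2 : 2 * n * Real.exp (-(k / 4 : ℝ)) ≤ 2 * b := by
    calc _ ≤ 2 * (n : ℝ) ^ 2 * Real.exp (-pr ^ 2 * N) :=
          mul_le_mul (by linarith) (hexp _ hkN) (Real.exp_pos _).le (by positivity)
      _ = 2 * b := by rw [hb]; ring
  have e3 : 2 ^ (x + 2) * Real.exp (-(n * mass p x / 4)) ≤ 4 * b := by
    have h1 : (2 : ℝ) ^ (x + 2) ≤ 4 * (n : ℝ) ^ 2 := by rw [pow_add]; linarith
    calc _ ≤ 4 * (n : ℝ) ^ 2 * Real.exp (-pr ^ 2 * N) :=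
          mul_le_mul h1 (hexp _ ((le_mul_of_one_le_left hN0.le hA).trans hmass))
            (Real.exp_pos _).le (by positivity)
      _ = 4 * b := by rw [hb]; ring
  have hb0 : 0 ≤ b := by positivity
  calc _ ≤ ENNReal.ofReal (4 * b) + (0 + (ENNReal.ofReal (2 * b) + (ENNReal.ofReal (2 * b) +
        ENNReal.ofReal (4 * b)))) := by
        refine (measure_mono hsub).trans ?_
        refine (measure_union_le _ _).trans (add_le_add ((law_relay_le hp0 hp1 hpr0 hpr1
          hn0.le x).trans (ENNReal.ofReal_le_ofReal e1)) ?_)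
        refine (measure_union_le _ _).trans (add_le_add (law_unit pr n hp0 hp1).le ?_)
        refine (measure_union_le _ _).trans (add_le_add ((law_local_count_le pr n hp0 hp1 hk1
          hxk).trans (ENNReal.ofReal_le_ofReal e2)) ?_)
        refine (measure_union_le _ _).trans (add_le_add ((law_thin_le pr n hp0 hp1 hk1
          hxk).trans (ENNReal.ofReal_le_ofReal e2)) ?_)
        exact (law_streetCount_le pr n hp0 hp1 x).trans (ENNReal.ofReal_le_ofReal e3)
    _ = ENNReal.ofReal (12 * b) := by
        rw [zero_add, ← ENNReal.ofReal_add (by positivity) (by positivity),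
          ← ENNReal.ofReal_add (by positivity) (by positivity),
          ← ENNReal.ofReal_add (by positivity) (by positivity)]
        congr 1
        ring

/-- The users of level greater than a diverging `x` are negligible in number compared with those of
one segment of the central cross. -/
theorem tendsto_law_high_users {p : ℝ} (pr : ℝ) (hp0 : 0 < p) (hp1 : p < 1) {x : ℕ → ℕ}
    (hx : Tendsto x atTop atTop) {ε : ℝ} (hε : 0 < ε) :
    Tendsto (fun n : ℕ => law p pr n n {ω | ε * (streetCount ω ⟨true, ⟨0, 0⟩⟩ : ℝ) ≤
      2 * ({i : Fin n | x n < (street ω i).level}.ncard : ℝ)}) atTop (𝓝 0) := by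
  have hlim : ∀ c : ℝ, 0 < c → Tendsto (fun n : ℕ => ENNReal.ofReal
      (4 * ((n : ℝ) ^ 2 * Real.exp (-c * (n : ℝ) ^ (1 - 0 : ℝ))))) atTop (𝓝 0) := by
    intro c hc
    have h := (tendsto_sq_mul_exp_neg (α := 0) (by norm_num) hc).const_mul 4
    rw [mul_zero] at h
    simpa only [ENNReal.ofReal_zero] using ENNReal.tendsto_ofReal h
  have hlim2 := (hlim (p / 8) (by positivity)).add (hlim (ε * p / 64) (by positivity))
  rw [add_zero] at hlim2
  refine tendsto_of_tendsto_of_tendsto_of_le_of_le' tendsto_const_nhds hlim2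
    (Eventually.of_forall fun _ => zero_le) ?_
  have hsmall : ∀ᶠ n : ℕ in atTop, (userLaw p).real {a | x n < a.1.level} < ε * p / 64 :=
    ((tendsto_userLaw_level_gt hp0 hp1).comp hx).eventually_lt_const (by positivity)
  filter_upwards [hsmall, eventually_ge_atTop 1] with n hs hn
  have hn1 : (1 : ℝ) ≤ n := by exact_mod_cast hn
  have hsq : (n : ℝ) ≤ (n : ℝ) ^ 2 := by nlinarith
  set k := ⌈ε * p * n / 16⌉₊ with hk
  have hkle : ε * p * n / 16 ≤ k := Nat.le_ceil _
  have hk1 : 1 ≤ k := Nat.ceil_pos.2 (by positivity)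
  have hm0 : mass p 0 = p / 2 := by simp [mass]
  have hsub : {ω : Config n | ε * (streetCount ω ⟨true, ⟨0, 0⟩⟩ : ℝ) ≤
      2 * ({i : Fin n | x n < (street ω i).level}.ncard : ℝ)} ⊆
      {ω | ∃ s : Street, s.level ≤ 0 ∧ (streetCount ω s : ℝ) ≤ n * mass p 0 / 4} ∪
      {ω | k ≤ {i : Fin n | x n < (street ω i).level}.ncard} := by
    intro ω hω
    by_contra hc
    simp only [Set.mem_union, Set.mem_ofPred_eq, not_or, not_exists, not_and, not_le] at hc hω
    have h1 := hc.1 ⟨true, ⟨0, 0⟩⟩ le_rfl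
    have h2 := Nat.lt_ceil.1 hc.2
    rw [hm0] at h1
    nlinarith
  refine (measure_mono hsub).trans ((measure_union_le _ _).trans (add_le_add ?_ ?_))
  · refine (law_streetCount_le pr n hp0 hp1 0).trans (ENNReal.ofReal_le_ofReal ?_)
    rw [hm0, sub_zero, Real.rpow_one]
    have : Real.exp (-(n * (p / 2) / 4)) = Real.exp (-(p / 8) * n) := by congr 1; ring
    rw [this]
    have := Real.exp_pos (-(p / 8) * n)
    nlinarith
  · refine (law_level_gt_le pr n hp0 hp1 hk1 (by nlinarith)).trans (ENNReal.ofReal_le_ofReal ?_)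
    rw [sub_zero, Real.rpow_one]
    have h1 : Real.exp (-(k / 4 : ℝ)) ≤ Real.exp (-(ε * p / 64) * n) :=
      Real.exp_le_exp.2 (by linarith)
    have := Real.exp_pos (-(ε * p / 64) * n)
    calc 2 * n * Real.exp (-(k / 4 : ℝ)) ≤ 2 * n * Real.exp (-(ε * p / 64) * n) :=
          mul_le_mul_of_nonneg_left h1 (by positivity)
      _ ≤ _ := by nlinarith

end Hyperfractal

/-! ### Hop counts in the giant component -/

open Hyperfractal in
theorem mainTheorem1 (p pr δ α cE Pmax θ : ℝ)
    (hp0 : 0 < p) (hp1 : p < 1) (hpr0 : 0 < pr) (hpr1 : pr < 1)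
    (hdF : 3 < userDim p) (hdr : relayDim pr < userDim p - 1)
    (hδ : 2 ≤ δ) (hα0 : 0 < α) (hα1 : α < 1) (hcE : 0 < cE) (hP : 0 < Pmax)
    (hθ0 : 0 ≤ θ) (hθ : θ < 1 / 2) :
    ∃ (C K : ℝ) (x : ℕ → ℕ),
      (∀ n : ℕ, |(x n : ℝ) - α * Real.log n / Real.log (2 / (1 - p))| ≤ K) ∧
      -- uniformly over all pairs of users in the giant component
      Tendsto (fun n : ℕ => law p pr n n {ω | ¬ ∀ u v : Fin n,
          u ∈ giant Pmax δ ω 1 (θ * budget Pmax δ α cE n) →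
          v ∈ giant Pmax δ ω 1 (θ * budget Pmax δ α cE n) →
          HopBound Pmax δ ω (budget Pmax δ α cE n)
            (C * (n : ℝ) ^ (1 - α / (userDim p - 1))) u v})
        atTop (𝓝 0) ∧
      -- all but a vanishing proportion of the pairs, with the full energy threshold
      (∀ ε : ℝ, 0 < ε → Tendsto (fun n : ℕ => law p pr n n {ω |
          ε * ((giant Pmax δ ω 1 (budget Pmax δ α cE n)).ncard : ℝ) ^ 2 <
            (({uv : Fin n × Fin n |
                uv.1 ∈ giant Pmax δ ω 1 (budget Pmax δ α cE n) ∧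
                uv.2 ∈ giant Pmax δ ω 1 (budget Pmax δ α cE n) ∧
                ¬ HopBound Pmax δ ω (budget Pmax δ α cE n)
                  (C * (n : ℝ) ^ (1 - α / (userDim p - 1))) uv.1 uv.2}.ncard : ℕ) : ℝ)})
        atTop (𝓝 0)) ∧
      -- the diverted route between the two segments of the central cross
      Tendsto (fun n : ℕ => law p pr n n {ω | ¬ ∀ u v : Fin n,
          (street ω u).level = 0 → (street ω v).level = 0 →
          (street ω u).horizontal ≠ (street ω v).horizontal →
          Diverted Pmax δ ω (x n) (budget Pmax δ α cE n)
            (C * (n : ℝ) ^ (1 - α / (userDim p - 1))) u v})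
        atTop (𝓝 0) := by
  have hq : 0 < 1 - p := by linarith
  have hη : 0 < 1 - 2 * θ := by linarith
  -- with this `A`, each of the five walks costs at most `(1 - 2 θ) / 5` of the budget
  set A : ℝ := max 1 (10 / ((1 - 2 * θ) * cE)) with hA
  have hA1 : 1 ≤ A := le_max_left _ _
  obtain ⟨m, hm⟩ : ∃ m : ℕ, A ≤ p / 8 * (2 / (1 - p)) ^ m := by
    obtain ⟨m, hm⟩ := pow_unbounded_of_one_lt (A / (p / 8))
      (show 1 < 2 / (1 - p) by rw [lt_div_iff₀ hq]; linarith)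
    exact ⟨m, by rw [div_lt_iff₀ (by positivity)] at hm; linarith⟩
  have hcost : ∀ n : ℕ, 5 * (2 / A * (n : ℝ) ^ ((1 - δ) * (1 - α)) * Pmax) ≤
      (1 - 2 * θ) * budget Pmax δ α cE n := by
    intro n
    have h1 : 10 / A ≤ (1 - 2 * θ) * cE := by
      rw [div_le_comm₀ (by linarith) (by positivity)]
      exact le_max_right _ _
    have h2 : 0 ≤ (n : ℝ) ^ ((1 - δ) * (1 - α)) * Pmax := by positivity
    calc _ = 10 / A * ((n : ℝ) ^ ((1 - δ) * (1 - α)) * Pmax) := by ring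
      _ ≤ (1 - 2 * θ) * cE * ((n : ℝ) ^ ((1 - δ) * (1 - α)) * Pmax) :=
          mul_le_mul_of_nonneg_right h1 h2
      _ = _ := by unfold budget; ring
  have hbud : ∀ n : ℕ, 0 ≤ budget Pmax δ α cE n := fun n => by unfold budget; positivity
  have hreg := tendsto_law_not_regular hp0 hp1 hpr0 hpr1 hdr hδ hα0 hα1 hP hA1 hm
  have hx := tendsto_divertLevel hp0 hp1 hα0 m
  refine ⟨7 * (2 ^ (m + 3) + 2), m + 1, divertLevel p α m,
    fun n => abs_divertLevel_sub_le hp0 hp1 hα0 m n, ?_, fun ε hε => ?_, ?_⟩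
  · refine tendsto_of_tendsto_of_tendsto_of_le_of_le' tendsto_const_nhds hreg
      (Eventually.of_forall fun _ => zero_le) ?_
    filter_upwards [eventually_ge_atTop 1] with n hn
    refine measure_mono fun ω hω hR => hω fun u v hu hv => ?_
    exact hR.hopBound_of_mem_giant hP (mul_nonneg hθ0 (hbud n)) hu hv (by linarith [hcost n])
      (cellBound_le hp1 hdF hα1 m hn)
  · have hlim := hreg.add (tendsto_law_high_users pr hp0 hp1 hx hε)
    rw [add_zero] at hlim
    refine tendsto_of_tendsto_of_tendsto_of_le_of_le' tendsto_const_nhds hlim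
      (Eventually.of_forall fun _ => zero_le) ?_
    filter_upwards [eventually_ge_atTop 1] with n hn
    refine (measure_mono fun ω hω => ?_).trans (measure_union_le _ _)
    by_contra hc
    simp only [Set.mem_union, Set.mem_ofPred_eq, not_or, not_not, not_le] at hc hω
    obtain ⟨hR, hH⟩ := hc
    have hE : 5 * (2 / A * (n : ℝ) ^ ((1 - δ) * (1 - α)) * Pmax) ≤ budget Pmax δ α cE n := by
      nlinarith [hcost n, hbud n]
    have hB : 5 * (cellBound p α m n : ℝ) ≤
        7 * (2 ^ (m + 3) + 2) * (n : ℝ) ^ (1 - α / (userDim p - 1)) :=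
      le_trans (by linarith [(Nat.cast_nonneg _ : (0 : ℝ) ≤ cellBound p α m n)])
        (cellBound_le hp1 hdF hα1 m hn)
    have hbad := hR.ncard_bad_pairs_le hP hE hB
    have hG : streetCount ω ⟨true, ⟨0, 0⟩⟩ ≤
        (giant Pmax δ ω 1 (budget Pmax δ α cE n)).ncard := by
      refine Set.ncard_le_ncard (fun i hi => ?_) (Set.toFinite _)
      have hi' : street ω i = ⟨true, ⟨0, 0⟩⟩ := hi
      exact mem_giant_of_level_eq_zero 1 (hbud n) (by rw [hi']; rfl)
    set G := (giant Pmax δ ω 1 (budget Pmax δ α cE n)).ncard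
    set H := {i : Fin n | divertLevel p α m n < (street ω i).level}.ncard
    have hbad' := hω.trans_le (Nat.cast_le (α := ℝ).2 hbad)
    have hG' : (streetCount ω ⟨true, ⟨0, 0⟩⟩ : ℝ) ≤ G := Nat.cast_le.2 hG
    have h1 : 2 * (H : ℝ) ≤ ε * G := hH.le.trans (mul_le_mul_of_nonneg_left hG' hε.le)
    push_cast at hbad'
    nlinarith [mul_le_mul_of_nonneg_left h1 (Nat.cast_nonneg G : (0 : ℝ) ≤ G)]
  · refine tendsto_of_tendsto_of_tendsto_of_le_of_le' tendsto_const_nhds hreg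
      (Eventually.of_forall fun _ => zero_le) ?_
    filter_upwards [eventually_ge_atTop 1, hx.eventually_gt_atTop 0] with n hn hx0
    refine measure_mono fun ω hω hR => hω fun u v hu hv huv => ?_
    refine hR.diverted hP hx0 hu hv huv ?_ ?_
    · nlinarith [hcost n, hbud n, hR.cost_nonneg hP]
    · exact le_trans (by linarith [(Nat.cast_nonneg _ : (0 : ℝ) ≤ cellBound p α m n)])
        (cellBound_le hp1 hdF hα1 m hn)
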